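/- Let $\mathcal{M}_n$ be the algebra of complex $n\times n$ matrices, with the trace inner product $\langle X,Y\rangle=\operatorname{tr}(XY^*)$. A self-adjoint positive linear map $T:\mathcal{M}_n\to\mathcal{M}_n$ is called completely reducible if there are orthogonal projections $W_1,\dots,W_l\in\mathcal{M}_n$ with $W_iW_j=0$ for $i\ne j$ such that, with $R$ the orthogonal complement of $\bigoplus_i W_i\mathcal{M}_nW_i$ (so that $\mathcal{M}_n=\bigoplus_i W_i\mathcal{M}_nW_i\oplus R$), one has $T(W_i\mathcal{M}_nW_i)\subset W_i\mathcal{M}_nW_i$ for every $i$, the restriction of $T$ to each $W_i\mathcal{M}_nW_i$ is irreducible, and $T|_R\equiv 0$. Here $T$ is irreducible on $V\mathcal{M}_nV$ if the only subalgebras $W\mathcal{M}_nW\subset V\mathcal{M}_nV$, with $W$ an orthogonal projection, that are left invariant by $T$ are those with $W=0$ or $W=V$. A state is a positive semidefinite Hermitian $\gamma\in\mathcal{M}_k\otimes\mathcal{M}_m$ (not normalized). For $\gamma=\sum_j A_j\otimes B_j$ put $G_\gamma(X)=\sum_j\operatorname{tr}(A_jX)B_j$ and $F_\gamma(Y)=\sum_j\operatorname{tr}(B_jY)A_j$.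 The state $\gamma$ is called completely reducible if $F_\gamma\circ G_\gamma:\mathcal{M}_k\to\mathcal{M}_k$ is completely reducible. For $\gamma_i=\sum_{j=1}^{n_i}A^i_j\otimes B^i_j\in\mathcal{M}_{k_i}\otimes\mathcal{M}_{m_i}$, $i=1,\dots,s$, the shuffle is $$S(\gamma_1,\dots,\gamma_s)=\sum_{j_1,\dots,j_s}A^1_{j_1}\otimes\cdots\otimes A^s_{j_s}\otimes B^1_{j_1}\otimes\cdots\otimes B^s_{j_s}\in\mathcal{M}_{k_1\cdots k_s}\otimes\mathcal{M}_{m_1\cdots m_s}.$$ Theorem. Let $\gamma_i\in\mathcal{M}_{k_i}\otimes\mathcal{M}_{m_i}$, $i=1,\dots,s$, be states. If every $\gamma_i$ is completely reducible, then $S(\gamma_1,\dots,\gamma_s)$ is a completely reducible state of $\mathcal{M}_{k_1\cdots k_s}\otimes\mathcal{M}_{m_1\cdots m_s}$. If all $\gamma_i$ are nonzero, then $S(\gamma_1,\dots,\gamma_s)$ is completely reducible if and only if every $\gamma_i$ is completely reducible. -/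

import Mathlib

open Matrix
open scoped Kronecker ComplexOrder

namespace ShuffleStates

/-! ### Complete reducibility of linear maps on matrix algebras -/

section Maps

variable {n : Type*} [Fintype n] [DecidableEq n]

/-- The set `V M V = {V X V : X ∈ M}`, where `M` is the algebra of all complex `n × n` matrices. -/
def corner (V : Matrix n n ℂ) : Submodule ℂ (Matrix n n ℂ) where
  carrier := {Y | ∃ X : Matrix n n ℂ, Y = V * X * V}
  add_mem' := by
    rintro _ _ ⟨X, rfl⟩ ⟨Y, rfl⟩
    exact ⟨X + Y, by rw [mul_add, add_mul]⟩
  zero_mem' := ⟨0, by simp⟩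
  smul_mem' := by
    rintro c _ ⟨X, rfl⟩
    exact ⟨c • X, by simp⟩

/-- The orthogonal complement of `S` for the trace inner product `⟨X, Y⟩ = tr (X Y*)`. -/
def traceOrthogonal (S : Submodule ℂ (Matrix n n ℂ)) : Submodule ℂ (Matrix n n ℂ) where
  carrier := {X | ∀ Y ∈ S, (X * Yᴴ).trace = 0}
  add_mem' := by
    intro X X' hX hX' Y hY
    rw [add_mul, trace_add, hX Y hY, hX' Y hY, add_zero]
  zero_mem' := by
    intro Y _
    simp
  smul_mem' := by
    intro c X hX Y hY
    rw [smul_mul, trace_smul, hX Y hY, smul_zero]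

/-- `T` leaves the subspace `S` invariant. -/
def LeavesInvariant (T : Matrix n n ℂ →ₗ[ℂ] Matrix n n ℂ) (S : Submodule ℂ (Matrix n n ℂ)) :
    Prop :=
  ∀ X ∈ S, T X ∈ S

/-- Irreducibility of the restriction of `T` to `V M V` (meant for a `T` which leaves `V M V`
invariant): the only subalgebras `W M W` of `V M V`, with `W` an orthogonal projection, that are
left invariant by `T` are those with `W = 0` or `W = V`. -/
def IsIrreducibleOn (T : Matrix n n ℂ →ₗ[ℂ] Matrix n n ℂ) (V : Matrix n n ℂ) : Prop :=
  ∀ W : Matrix n n ℂ, IsStarProjection W → corner W ≤ corner V →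
    LeavesInvariant T (corner W) → W = 0 ∨ W = V

/-- Complete reducibility of a (self-adjoint, positive) linear map `T : M → M`: there are mutually
orthogonal orthogonal projections `W₁, …, W_l` such that `M = ⨁ Wᵢ M Wᵢ ⊕ R`, where `R` is the
orthogonal complement of `⨁ Wᵢ M Wᵢ` for the trace inner product, each `Wᵢ M Wᵢ` is left invariant
by `T`, the restriction of `T` to each `Wᵢ M Wᵢ` is irreducible, and `T` vanishes on `R`. -/
def IsCompletelyReducibleMap (T : Matrix n n ℂ →ₗ[ℂ] Matrix n n ℂ) : Prop :=
  ∃ (l : ℕ) (W : Fin l → Matrix n n ℂ),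
    (∀ i, IsStarProjection (W i)) ∧
    (∀ i j, i ≠ j → W i * W j = 0) ∧
    iSupIndep (fun i => corner (W i)) ∧
    IsCompl (⨆ i, corner (W i)) (traceOrthogonal (⨆ i, corner (W i))) ∧
    (∀ i, LeavesInvariant T (corner (W i))) ∧
    (∀ i, IsIrreducibleOn T (W i)) ∧
    (∀ X ∈ traceOrthogonal (⨆ i, corner (W i)), T X = 0)

/-- The sum of the subalgebras of mutually orthogonal projections is automatically direct. -/
theorem iSupIndep_corner {ι : Type*} {W : ι → Matrix n n ℂ}
    (hW : ∀ i, IsStarProjection (W i)) (horth : ∀ i j, i ≠ j → W i * W j = 0) :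
    iSupIndep (fun i => corner (W i)) := by
  intro i
  rw [Submodule.disjoint_def]
  rintro X ⟨Y, rfl⟩ hX
  let L : Matrix n n ℂ →ₗ[ℂ] Matrix n n ℂ :=
    { toFun := fun Z => W i * Z * W i
      map_add' := fun A B => by rw [mul_add, add_mul]
      map_smul' := fun c A => by simp }
  have hle : (⨆ j, ⨆ _ : j ≠ i, corner (W j)) ≤ LinearMap.ker L := by
    refine iSup_le fun j => iSup_le fun hj => ?_
    rintro _ ⟨Z, rfl⟩
    change W i * (W j * Z * W j) * W i = 0
    rw [← mul_assoc, ← mul_assoc, horth i j hj.symm]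
    simp
  have h0 : W i * (W i * Y * W i) * W i = 0 := hle hX
  have hid : W i * W i = W i := (hW i).isIdempotentElem
  calc W i * Y * W i = (W i * W i) * Y * (W i * W i) := by rw [hid]
    _ = W i * (W i * Y * W i) * W i := by simp only [mul_assoc]
    _ = 0 := h0

/-- The decomposition of `M` into this sum and its orthogonal complement is automatic. -/
theorem isCompl_corner {l : ℕ} {W : Fin l → Matrix n n ℂ}
    (hW : ∀ i, IsStarProjection (W i)) (horth : ∀ i j, i ≠ j → W i * W j = 0) :
    IsCompl (⨆ i, corner (W i)) (traceOrthogonal (⨆ i, corner (W i))) := by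
  have hid : ∀ i, W i * W i = W i := fun i => (hW i).isIdempotentElem
  have hsa : ∀ i, (W i)ᴴ = W i := fun i => (hW i).isSelfAdjoint
  constructor
  · rw [Submodule.disjoint_def]
    intro X hX hX'
    exact trace_mul_conjTranspose_self_eq_zero_iff.1 (hX' X hX)
  · rw [codisjoint_iff, eq_top_iff]
    intro X _
    have h1 : ∑ i, W i * X * W i ∈ ⨆ i, corner (W i) :=
      Submodule.sum_mem _ fun i _ => Submodule.mem_iSup_of_mem i ⟨X, rfl⟩
    have h2 : X - ∑ i, W i * X * W i ∈ traceOrthogonal (⨆ i, corner (W i)) := by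
      intro Y hY
      induction hY using Submodule.iSup_induction' with
      | zero => simp
      | add A B _ _ hA hB => rw [conjTranspose_add, mul_add, trace_add, hA, hB, add_zero]
      | mem j A hA =>
        obtain ⟨Z, rfl⟩ := hA
        have e1 : (W j * Z * W j)ᴴ = W j * Zᴴ * W j := by
          simp [conjTranspose_mul, hsa, mul_assoc]
        have e2 : (∑ i, W i * X * W i) * W j = W j * X * W j := by
          rw [Finset.sum_mul, Finset.sum_eq_single j]
          · rw [mul_assoc, hid]
          · intro b _ hb
            rw [mul_assoc, horth b j hb, mul_zero]
          · simp
        rw [e1, sub_mul, trace_sub, ← mul_assoc, ← mul_assoc, ← mul_assoc, ← mul_assoc, e2,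
          trace_mul_comm (X * W j * Zᴴ), trace_mul_comm (W j * X * W j * Zᴴ)]
        simp only [← mul_assoc]
        rw [hid, sub_self]
    have := Submodule.add_mem_sup h1 h2
    simpa using this

end Maps

/-! ### Bipartite states

`M_k ⊗ M_m` is identified with the complex matrices indexed by `k × m` through the Kronecker
product. -/

section States

variable {k m : Type*}

/-- The linear map `G_γ : M_k → M_m`, `G_γ X = ∑ᵢ tr (Aᵢ X) Bᵢ` for `γ = ∑ᵢ Aᵢ ⊗ Bᵢ`
(see `mapG_sum_kronecker`), written in the entries of `γ`. -/
def mapG [Fintype k] (γ : Matrix (k × m) (k × m) ℂ) : Matrix k k ℂ →ₗ[ℂ] Matrix m m ℂ where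
  toFun X := Matrix.of fun b b' => ∑ a, ∑ a', γ (a, b) (a', b') * X a' a
  map_add' X Y := by
    ext b b'
    simp [mul_add, Finset.sum_add_distrib]
  map_smul' c X := by
    ext b b'
    simp [Finset.mul_sum, mul_left_comm]

/-- The linear map `F_γ : M_m → M_k`, `F_γ Y = ∑ᵢ tr (Bᵢ Y) Aᵢ` for `γ = ∑ᵢ Aᵢ ⊗ Bᵢ`
(see `mapF_sum_kronecker`), written in the entries of `γ`. -/
def mapF [Fintype m] (γ : Matrix (k × m) (k × m) ℂ) : Matrix m m ℂ →ₗ[ℂ] Matrix k k ℂ where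
  toFun Y := Matrix.of fun a a' => ∑ b, ∑ b', γ (a, b) (a', b') * Y b' b
  map_add' X Y := by
    ext b b'
    simp [mul_add, Finset.sum_add_distrib]
  map_smul' c X := by
    ext b b'
    simp [Finset.mul_sum, mul_left_comm]

theorem mapG_sum_kronecker [Fintype k] {ι : Type*} [Fintype ι] (A : ι → Matrix k k ℂ) (B : ι → Matrix m m ℂ)
    (X : Matrix k k ℂ) :
    mapG (∑ i, A i ⊗ₖ B i) X = ∑ i, (A i * X).trace • B i := by
  ext b b'
  simp only [mapG, LinearMap.coe_mk, AddHom.coe_mk, of_apply, Matrix.sum_apply, kroneckerMap_apply,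
    Matrix.smul_apply, smul_eq_mul, trace, diag_apply, mul_apply, Finset.sum_mul]
  conv_rhs => rw [Finset.sum_comm]
  refine Finset.sum_congr rfl fun a _ => ?_
  conv_rhs => rw [Finset.sum_comm]
  exact Finset.sum_congr rfl fun a' _ => Finset.sum_congr rfl fun i _ => by ring

theorem mapF_sum_kronecker [Fintype m] {ι : Type*} [Fintype ι] (A : ι → Matrix k k ℂ) (B : ι → Matrix m m ℂ)
    (Y : Matrix m m ℂ) :
    mapF (∑ i, A i ⊗ₖ B i) Y = ∑ i, (B i * Y).trace • A i := by
  ext a a'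
  simp only [mapF, LinearMap.coe_mk, AddHom.coe_mk, of_apply, Matrix.sum_apply, kroneckerMap_apply,
    Matrix.smul_apply, smul_eq_mul, trace, diag_apply, mul_apply, Finset.sum_mul]
  conv_rhs => rw [Finset.sum_comm]
  refine Finset.sum_congr rfl fun b _ => ?_
  conv_rhs => rw [Finset.sum_comm]
  exact Finset.sum_congr rfl fun b' _ => Finset.sum_congr rfl fun i _ => by ring

/-- `γ ∈ M_k ⊗ M_m` is a completely reducible state: it is positive semidefinite and
`F_γ ∘ G_γ : M_k → M_k` is completely reducible. -/
def IsCompletelyReducibleState [Fintype k] [Fintype m] [DecidableEq k]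
    (γ : Matrix (k × m) (k × m) ℂ) : Prop :=
  γ.PosSemidef ∧ IsCompletelyReducibleMap (mapF γ ∘ₗ mapG γ)

end States

/-! ### The shuffle

`M_{k₁⋯k_s} = M_{k₁} ⊗ ⋯ ⊗ M_{k_s}` is identified with the complex matrices indexed by
`∏ᵢ kᵢ` (tuples of indices). -/

section Shuffle

variable {σ : Type*} [Fintype σ]

/-- The tensor (Kronecker) product `A₁ ⊗ ⋯ ⊗ A_s`. -/
def tensor {k : σ → Type*} (A : ∀ i, Matrix (k i) (k i) ℂ) :
    Matrix (∀ i, k i) (∀ i, k i) ℂ :=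
  Matrix.of fun a a' => ∏ i, A i (a i) (a' i)

/-- The shuffle `S(γ₁, …, γ_s) = ∑ A¹ ⊗ ⋯ ⊗ Aˢ ⊗ B¹ ⊗ ⋯ ⊗ Bˢ` of `γᵢ = ∑ⱼ Aⁱⱼ ⊗ Bⁱⱼ`
(see `shuffle_sum_kronecker`), written in the entries of the `γᵢ`. -/
def shuffle {k m : σ → Type*} (γ : ∀ i, Matrix (k i × m i) (k i × m i) ℂ) :
    Matrix ((∀ i, k i) × (∀ i, m i)) ((∀ i, k i) × (∀ i, m i)) ℂ :=
  Matrix.of fun p q => ∏ i, γ i (p.1 i, p.2 i) (q.1 i, q.2 i)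

theorem shuffle_sum_kronecker [DecidableEq σ] {k m : σ → Type*} {J : σ → Type*}
    [∀ i, Fintype (J i)]
    (A : ∀ i, J i → Matrix (k i) (k i) ℂ) (B : ∀ i, J i → Matrix (m i) (m i) ℂ) :
    shuffle (fun i => ∑ j, A i j ⊗ₖ B i j) =
      ∑ j : ∀ i, J i, tensor (fun i => A i (j i)) ⊗ₖ tensor (fun i => B i (j i)) := by
  ext p q
  simp only [shuffle, tensor, of_apply, Matrix.sum_apply, kroneckerMap_apply,
    ← Finset.prod_mul_distrib]
  exact Fintype.prod_sum fun i j => A i j (p.1 i) (q.1 i) * B i j (p.2 i) (q.2 i)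

end Shuffle

end ShuffleStates

/-! Put `T = F_γ ∘ G_γ`. As `F_γ` is adjoint to `G_γ` for the trace form, `T` is a positive map that
is self-adjoint with nonnegative spectrum. On product matrices the map attached to the shuffle is
the tensor product of the maps attached to the factors, so the theorem is about tensor products of
such maps.

Perron–Frobenius theory (`exists_perron`) says that on an irreducible block where `T` does not
vanish, the top eigenvalue is simple, with an eigenvector whose support is the whole block.
Conversely, a simple eigenvalue with a positive semidefinite eigenvector of full support forces
irreducibility (`isIrreducibleOn_of_simple`).

Complete reducibility of factors passes to the tensor product by taking tensor products of
nonvanishing blocks. If `r i` is the top eigenvalue on the chosen block of the `i`-th factor, then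
`∏ r i` is a product of eigenvalues of the factors only when each of them is top, because none is
negative. Hence it is simple, its eigenvector is the product of the Perron vectors, and the product
block is irreducible (`IsBlockSystem.tensor`).

For the converse, complete reducibility is traded for a statement about eigenvectors,
`HasDecompositionProperty`: `T` kills `V M (1 - V)` whenever `V` is the support of a positive
semidefinite eigenvector with positive eigenvalue. It follows from complete reducibility because
such a `V` contains or annihilates each block, and it gives complete reducibility by splitting off
minimal supports one at a time. It descends to a factor: fill the other slots with positive
semidefinite eigenvectors of positive eigenvalue, which exist when the states are nonzero, and read
off the remaining slot (`HasDecompositionProperty.of_tensor`). -/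

namespace ShuffleStates

/-! ### Positive semidefinite matrices, support projections and corners. -/

section Prelim

variable {n : Type*} [Fintype n] [DecidableEq n]

theorem exists_eq_conjTranspose_mul_self {A : Matrix n n ℂ} (hA : A.PosSemidef) :
    ∃ a : Matrix n n ℂ, A = aᴴ * a := by
  open scoped MatrixOrder in
  exact CStarAlgebra.nonneg_iff_eq_star_mul_self.1 (nonneg_iff_posSemidef.2 hA)

theorem trace_mul_nonneg {A B : Matrix n n ℂ} (hA : A.PosSemidef) (hB : B.PosSemidef) :
    0 ≤ (A * B).trace := by
  obtain ⟨a, rfl⟩ := exists_eq_conjTranspose_mul_self hA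
  rw [mul_assoc, trace_mul_comm]
  exact (hB.mul_mul_conjTranspose_same a).trace_nonneg

/-- With `A = a* a` and `B = b* b`, the trace of `A B` is the squared norm of `a b*`. -/
theorem mul_eq_zero_of_trace_mul_eq_zero {A B : Matrix n n ℂ} (hA : A.PosSemidef)
    (hB : B.PosSemidef) (h : (A * B).trace = 0) : A * B = 0 := by
  obtain ⟨a, rfl⟩ := exists_eq_conjTranspose_mul_self hA
  obtain ⟨b, rfl⟩ := exists_eq_conjTranspose_mul_self hB
  have h1 : a * bᴴ = 0 := by
    rw [← trace_mul_conjTranspose_self_eq_zero_iff]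
    rw [← h, trace_mul_comm (a * bᴴ)]
    simp only [conjTranspose_mul, conjTranspose_conjTranspose, mul_assoc]
    rw [trace_mul_comm]
    simp only [mul_assoc]
  calc aᴴ * a * (bᴴ * b) = aᴴ * (a * bᴴ) * b := by simp only [mul_assoc]
    _ = 0 := by rw [h1]; simp

theorem exists_posSemidef_sub {Y : Matrix n n ℂ} (hY : Y.IsHermitian) :
    ∃ P N : Matrix n n ℂ, P.PosSemidef ∧ N.PosSemidef ∧ Y = P - N ∧ P * N = 0 := by
  open scoped MatrixOrder in
  exact ⟨Y⁺, Y⁻, nonneg_iff_posSemidef.1 (CFC.posPart_nonneg Y),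
    nonneg_iff_posSemidef.1 (CFC.negPart_nonneg Y),
    (CFC.posPart_sub_negPart Y hY).symm, CFC.posPart_mul_negPart Y⟩

/-- `V` is the support projection of `X`, with `D` a generalized inverse of `X`. -/
structure IsSupport (V X D : Matrix n n ℂ) : Prop where
  isStarProjection : IsStarProjection V
  mul_left : V * X = X
  mul_right : X * V = X
  eq_mul : V = X * D
  eq_mul' : V = D * X

theorem exists_isSupport {X : Matrix n n ℂ} (hX : X.IsHermitian) :
    ∃ V D : Matrix n n ℂ, IsSupport V X D := by
  classical
  let U : Matrix n n ℂ := hX.eigenvectorUnitary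
  let d : n → ℂ := fun i => (hX.eigenvalues i : ℂ)
  have hU : Uᴴ * U = 1 := (Matrix.mem_unitaryGroup_iff'.1 hX.eigenvectorUnitary.2)
  have hXe : X = U * diagonal d * Uᴴ := by
    have := hX.spectral_theorem
    rw [Unitary.conjStarAlgAut_apply] at this
    exact this
  let c : (n → ℂ) → Matrix n n ℂ := fun f => U * diagonal f * Uᴴ
  have hc : ∀ f g, c f * c g = c (fun i => f i * g i) := by
    intro f g
    calc c f * c g = U * diagonal f * (Uᴴ * U) * diagonal g * Uᴴ := by simp only [c, mul_assoc]
      _ = _ := by rw [hU, mul_one, mul_assoc U, diagonal_mul_diagonal]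
  let e : n → ℂ := fun i => if d i = 0 then 0 else 1
  have hd : X = c d := hXe
  -- In an eigenbasis, `V` is the indicator of the nonzero eigenvalues and `D` inverts them. The
  -- convention `0⁻¹ = 0` is what makes `X D` and `D X` equal to `V`.
  refine ⟨c e, c (fun i => (d i)⁻¹), ⟨?_, ?_⟩, ?_, ?_, ?_, ?_⟩
  · change c e * c e = c e
    rw [hc]; congr 1; ext i; by_cases h : d i = 0 <;> simp [e, h]
  · change (c e)ᴴ = c e
    simp only [c, conjTranspose_mul, conjTranspose_conjTranspose, diagonal_conjTranspose, mul_assoc]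
    congr 3; ext i; by_cases h : d i = 0 <;> simp [e, h]
  · rw [hd, hc]; congr 1; ext i; by_cases h : d i = 0 <;> simp [e, h]
  · rw [hd, hc]; congr 1; ext i; by_cases h : d i = 0 <;> simp [e, h]
  · rw [hd, hc]; congr 1; ext i; by_cases h : d i = 0 <;> simp [e, h]
  · rw [hd, hc]; congr 1; ext i; by_cases h : d i = 0 <;> simp [e, h]

omit [Fintype n] [DecidableEq n] in
theorem exists_isHermitian_add (A : Matrix n n ℂ) :
    ∃ H K : Matrix n n ℂ, H.IsHermitian ∧ K.IsHermitian ∧ A = H + Complex.I • K := by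
  refine ⟨realPart A, imaginaryPart A, (realPart A).2, (imaginaryPart A).2, ?_⟩
  exact (realPart_add_I_smul_imaginaryPart A).symm

/-- A linear map is determined by its values on positive semidefinite matrices. -/
theorem eq_zero_of_posSemidef {E : Type*} [AddCommGroup E] [Module ℂ E]
    (L : Matrix n n ℂ →ₗ[ℂ] E) (h : ∀ A : Matrix n n ℂ, A.PosSemidef → L A = 0) : L = 0 := by
  have hH : ∀ H : Matrix n n ℂ, H.IsHermitian → L H = 0 := by
    intro H hH
    obtain ⟨P, N, hP, hN, rfl, -⟩ := exists_posSemidef_sub hH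
    rw [map_sub, h P hP, h N hN, sub_zero]
  ext1 A
  obtain ⟨H, K, h1, h2, rfl⟩ := exists_isHermitian_add A
  simp [hH H h1, hH K h2]

omit [DecidableEq n] in
theorem IsStarProjection.posSemidef {V : Matrix n n ℂ} (hV : IsStarProjection V) :
    V.PosSemidef := by
  have h : V = Vᴴ * V := by
    rw [show Vᴴ = V from hV.isSelfAdjoint, hV.isIdempotentElem.eq]
  rw [h]
  exact posSemidef_conjTranspose_mul_self V

theorem mem_corner {V : Matrix n n ℂ} (hV : IsStarProjection V) {X : Matrix n n ℂ} :
    X ∈ corner V ↔ V * X = X ∧ X * V = X := by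
  have h := hV.isIdempotentElem.eq
  constructor
  · rintro ⟨Y, rfl⟩
    refine ⟨?_, ?_⟩
    · rw [← mul_assoc, ← mul_assoc, h]
    · rw [mul_assoc, h]
  · rintro ⟨h1, h2⟩
    exact ⟨X, by rw [h1, h2]⟩

theorem corner_le_iff {W V : Matrix n n ℂ} (hW : IsStarProjection W) (hV : IsStarProjection V) :
    corner W ≤ corner V ↔ V * W = W ∧ W * V = W := by
  constructor
  · intro h
    exact (mem_corner hV).1 (h ⟨1, by rw [mul_one, hW.isIdempotentElem.eq]⟩)
  · rintro ⟨h1, h2⟩ X hX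
    obtain ⟨h3, h4⟩ := (mem_corner hW).1 hX
    refine (mem_corner hV).2 ⟨?_, ?_⟩
    · rw [← h3, ← mul_assoc, h1]
    · rw [← h4, mul_assoc, h2]

/-- The compression `X ↦ V X V`. -/
def compression (V : Matrix n n ℂ) : Matrix n n ℂ →ₗ[ℂ] Matrix n n ℂ where
  toFun X := V * X * V
  map_add' X Y := by rw [mul_add, add_mul]
  map_smul' c X := by simp

end Prelim

/-! ### Rayleigh quotients of symmetric operators. -/

section Spectral

variable {E : Type*} [NormedAddCommGroup E] [InnerProductSpace ℂ E] [FiniteDimensional ℂ E]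

/-- In an eigenbasis, `r ‖x‖² - ⟨T x, x⟩` is the sum of `(r - μ j) |⟨b j, x⟩|²` with `r` the largest
`μ j`. Equality kills every coordinate outside the top eigenspace. -/
theorem exists_top_eigenvalue [Nontrivial E] {T : E →ₗ[ℂ] E} (hT : T.IsSymmetric) :
    ∃ r : ℝ, (∃ x ≠ 0, T x = (r : ℂ) • x) ∧
      (∀ x, (inner ℂ (T x) x).re ≤ r * (inner ℂ x x).re) ∧
      ∀ x, (inner ℂ (T x) x).re = r * (inner ℂ x x).re → T x = (r : ℂ) • x := by
  let b := hT.eigenvectorBasis rfl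
  let μ := hT.eigenvalues rfl
  have hb : ∀ j, T (b j) = (μ j : ℂ) • b j := hT.apply_eigenvectorBasis rfl
  have : Nonempty (Fin (Module.finrank ℂ E)) := ⟨⟨0, Module.finrank_pos⟩⟩
  obtain ⟨j0, hj0⟩ := Finite.exists_max μ
  have key : ∀ x, μ j0 * (inner ℂ x x).re - (inner ℂ (T x) x).re =
      ∑ j, (μ j0 - μ j) * Complex.normSq (inner ℂ (b j) x) := by
    intro x
    have h1 := b.sum_inner_mul_inner x x
    have h2 := b.sum_inner_mul_inner (T x) x
    rw [← h1, ← h2, Complex.re_sum, Complex.re_sum, Finset.mul_sum, ← Finset.sum_sub_distrib]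
    refine Finset.sum_congr rfl fun j _ => ?_
    rw [hT x (b j), hb, inner_smul_right, ← inner_conj_symm x (b j), mul_assoc,
      ← Complex.normSq_eq_conj_mul_self]
    simp
    ring
  have hnn : ∀ x, ∀ j ∈ Finset.univ, 0 ≤ (μ j0 - μ j) * Complex.normSq (inner ℂ (b j) x) :=
    fun x j _ => mul_nonneg (sub_nonneg.2 (hj0 j)) (Complex.normSq_nonneg _)
  refine ⟨μ j0, ⟨b j0, b.orthonormal.ne_zero j0, hb j0⟩, ?_, ?_⟩
  · intro x
    have := Finset.sum_nonneg (hnn x)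
    rw [← key] at this
    linarith
  · intro x hx
    have h0 : ∑ j, (μ j0 - μ j) * Complex.normSq (inner ℂ (b j) x) = 0 := by
      rw [← key, hx, sub_self]
    rw [Finset.sum_eq_zero_iff_of_nonneg (hnn x)] at h0
    refine InnerProductSpace.ext_inner_left_basis b.toBasis fun j => ?_
    rw [OrthonormalBasis.coe_toBasis, ← hT, hb, inner_smul_left, inner_smul_right]
    rcases mul_eq_zero.1 (h0 j (Finset.mem_univ j)) with h | h
    · rw [sub_eq_zero.1 h]; simp
    · rw [Complex.normSq_eq_zero.1 h]; simp

end Spectral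

/-! ### Perron–Frobenius theory for self-adjoint positive maps. -/

section Perron

variable {n : Type*} [Fintype n] [DecidableEq n]

/-- A positive map on matrices which is self-adjoint and nonnegative as an operator for the trace
inner product. -/
structure IsSelfAdjointPositive (T : Matrix n n ℂ →ₗ[ℂ] Matrix n n ℂ) : Prop where
  posSemidef : ∀ X, X.PosSemidef → (T X).PosSemidef
  map_conjTranspose : ∀ X, T Xᴴ = (T X)ᴴ
  trace_mul : ∀ X Y, (T X * Y).trace = (X * T Y).trace
  trace_nonneg : ∀ X, 0 ≤ (T X * Xᴴ).trace

/-- `r` bounds the Rayleigh quotient of `T`, and the bound is attained only at eigenvectors. -/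
structure IsTopValue (T : Matrix n n ℂ →ₗ[ℂ] Matrix n n ℂ) (r : ℝ) : Prop where
  le : ∀ X, (T X * Xᴴ).trace.re ≤ r * (X * Xᴴ).trace.re
  eq : ∀ X, (T X * Xᴴ).trace.re = r * (X * Xᴴ).trace.re → T X = (r : ℂ) • X

/-- The trace inner product. -/
@[reducible]
def traceInnerCore : InnerProductSpace.Core ℂ (Matrix n n ℂ) where
  inner X Y := (Y * Xᴴ).trace
  conj_inner_symm X Y := by
    change star (X * Yᴴ).trace = (Y * Xᴴ).trace
    rw [← trace_conjTranspose, conjTranspose_mul, conjTranspose_conjTranspose]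
  re_inner_nonneg X := (Complex.nonneg_iff.1 (posSemidef_self_mul_conjTranspose X).trace_nonneg).1
  add_left X Y Z := by simp [mul_add]
  smul_left X Y c := by simp
  definite X hX := trace_mul_conjTranspose_self_eq_zero_iff.1 hX

omit [DecidableEq n] in
theorem trace_mul_conjTranspose_re_pos {X : Matrix n n ℂ} (hX : X ≠ 0) :
    0 < (X * Xᴴ).trace.re := by
  have h := (Complex.nonneg_iff.1 (posSemidef_self_mul_conjTranspose X).trace_nonneg)
  refine lt_of_le_of_ne h.1 fun h0 => hX ?_
  rw [← trace_mul_conjTranspose_self_eq_zero_iff]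
  exact Complex.ext h0.symm h.2.symm

namespace IsSelfAdjointPositive

variable {T : Matrix n n ℂ →ₗ[ℂ] Matrix n n ℂ}

omit [DecidableEq n] in
theorem inner_symm (hT : IsSelfAdjointPositive T) (X Y : Matrix n n ℂ) :
    (Y * (T X)ᴴ).trace = (T Y * Xᴴ).trace := by
  rw [← hT.map_conjTranspose, hT.trace_mul]

/-- The top eigenvalue is positive because the quadratic form of `T` is nonnegative: were `r ≤ 0`,
every matrix would attain the bound with `r = 0` and `T` would vanish. -/
theorem exists_isTopValue (hT : IsSelfAdjointPositive T) (h0 : T ≠ 0) :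
    ∃ r : ℝ, 0 < r ∧ IsTopValue T r ∧ ∃ X ≠ 0, T X = (r : ℂ) • X := by
  let : NormedAddCommGroup (Matrix n n ℂ) := traceInnerCore.toNormedAddCommGroup
  let : InnerProductSpace ℂ (Matrix n n ℂ) := InnerProductSpace.ofCore traceInnerCore.toCore
  have hsymm : T.IsSymmetric := fun X Y => by
    change (Y * (T X)ᴴ).trace = (T Y * Xᴴ).trace
    exact hT.inner_symm X Y
  have hnt : Nontrivial (Matrix n n ℂ) := by
    by_contra h
    rw [not_nontrivial_iff_subsingleton] at h
    exact h0 (LinearMap.ext fun X => Subsingleton.elim _ _)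
  obtain ⟨r, hr, hle, heq⟩ := exists_top_eigenvalue hsymm
  have hin : ∀ X, inner ℂ (T X) X = (T X * Xᴴ).trace := fun X => hT.inner_symm X X
  have hin' : ∀ X : Matrix n n ℂ, inner ℂ X X = (X * Xᴴ).trace := fun X => rfl
  simp only [hin, hin'] at hle heq
  refine ⟨r, ?_, ⟨hle, heq⟩, hr⟩
  by_contra hneg
  push Not at hneg
  refine h0 (LinearMap.ext fun X => ?_)
  by_contra hX
  have hX0 : X ≠ 0 := by rintro rfl; simp at hX
  have h1 := (Complex.nonneg_iff.1 (hT.trace_nonneg X)).1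
  have h2 := hle X
  have h3 := trace_mul_conjTranspose_re_pos hX0
  have h4 : r = 0 := by
    refine le_antisymm hneg ?_
    by_contra h
    push Not at h
    nlinarith
  have h5 := heq X (le_antisymm h2 (by rw [h4, zero_mul]; exact h1))
  rw [h4] at h5
  exact hX (by simpa using h5)

theorem exists_eigenbasis (hT : IsSelfAdjointPositive T) :
    ∃ (N : ℕ) (b : Module.Basis (Fin N) ℂ (Matrix n n ℂ)) (μ : Fin N → ℝ),
      ∀ j, T (b j) = (μ j : ℂ) • b j := by
  let : NormedAddCommGroup (Matrix n n ℂ) := traceInnerCore.toNormedAddCommGroup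
  let : InnerProductSpace ℂ (Matrix n n ℂ) := InnerProductSpace.ofCore traceInnerCore.toCore
  have hsymm : T.IsSymmetric := fun X Y => by
    change (Y * (T X)ᴴ).trace = (T Y * Xᴴ).trace
    exact hT.inner_symm X Y
  refine ⟨_, (hsymm.eigenvectorBasis rfl).toBasis, hsymm.eigenvalues rfl, fun j => ?_⟩
  rw [OrthonormalBasis.coe_toBasis]
  exact hsymm.apply_eigenvectorBasis rfl j

theorem compress (hT : IsSelfAdjointPositive T) {V : Matrix n n ℂ} (hV : Vᴴ = V) :
    IsSelfAdjointPositive (compression V ∘ₗ T ∘ₗ compression V) := by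
  have hpos : ∀ X : Matrix n n ℂ, X.PosSemidef → (V * X * V).PosSemidef := fun X hX => by
    have := hX.mul_mul_conjTranspose_same V
    rwa [hV] at this
  have hct : ∀ X : Matrix n n ℂ, (V * X * V)ᴴ = V * Xᴴ * V := fun X => by
    simp [conjTranspose_mul, hV, mul_assoc]
  have htr : ∀ X Y : Matrix n n ℂ, (V * X * V * Y).trace = (X * (V * Y * V)).trace := fun X Y => by
    rw [mul_assoc, mul_assoc, trace_mul_comm]
    simp only [mul_assoc]
  refine ⟨fun X hX => hpos _ (hT.posSemidef _ (hpos X hX)), fun X => ?_, fun X Y => ?_, fun X => ?_⟩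
  · change V * T (V * Xᴴ * V) * V = (V * T (V * X * V) * V)ᴴ
    rw [hct, ← hct X, hT.map_conjTranspose]
  · change (V * T (V * X * V) * V * Y).trace = (X * (V * T (V * Y * V) * V)).trace
    rw [htr, hT.trace_mul, htr]
  · change 0 ≤ (V * T (V * X * V) * V * Xᴴ).trace
    rw [htr, ← hct]
    exact hT.trace_nonneg _

/-- Since `P N = 0`, passing from `P - N` to `P + N` keeps the norm, while positivity of `T` can
only raise the quadratic form, by `2 (tr (T P N) + tr (T N P))`. So `P + N` also attains the maximum
and is an eigenvector; half the sum and half the difference give `P` and `N`. -/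
theorem eigen_of_mul_eq_zero (hT : IsSelfAdjointPositive T) {r : ℝ} (hr : IsTopValue T r)
    {P N : Matrix n n ℂ} (hP : P.PosSemidef) (hN : N.PosSemidef) (hPN : P * N = 0)
    (h : T (P - N) = (r : ℂ) • (P - N)) : T P = (r : ℂ) • P ∧ T N = (r : ℂ) • N := by
  have hNP : N * P = 0 := by
    have := congrArg conjTranspose hPN
    rwa [conjTranspose_mul, conjTranspose_zero, hP.isHermitian.eq, hN.isHermitian.eq] at this
  have hQ : T (P + N) = (r : ℂ) • (P + N) := by
    apply hr.eq
    refine le_antisymm (hr.le _) ?_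
    have e1 : ((P + N) * (P + N)ᴴ).trace = ((P - N) * (P - N)).trace := by
      rw [conjTranspose_add, hP.isHermitian.eq, hN.isHermitian.eq]
      simp [mul_add, add_mul, mul_sub, sub_mul, hPN, hNP]
    have e2 : (T (P + N) * (P + N)ᴴ).trace =
        (T (P - N) * (P - N)).trace + 2 * ((T P * N).trace + (T N * P).trace) := by
      rw [conjTranspose_add, hP.isHermitian.eq, hN.isHermitian.eq]
      simp only [map_add, map_sub, mul_add, add_mul, mul_sub, sub_mul, trace_add, trace_sub]
      ring
    have p1 := (Complex.nonneg_iff.1 (trace_mul_nonneg (hT.posSemidef P hP) hN)).1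
    have p2 := (Complex.nonneg_iff.1 (trace_mul_nonneg (hT.posSemidef N hN) hP)).1
    rw [e1, e2, h, smul_mul, trace_smul]
    simp
    linarith
  have h1 : (2 : ℂ) • P = (P + N) + (P - N) := by rw [two_smul]; abel
  have h2 : (2 : ℂ) • N = (P + N) - (P - N) := by rw [two_smul]; abel
  have two : (2 : ℂ) ≠ 0 := two_ne_zero
  constructor
  · apply smul_right_injective _ two
    change (2 : ℂ) • T P = (2 : ℂ) • (r : ℂ) • P
    rw [← map_smul, smul_comm, h1, map_add, hQ, h, ← smul_add]
  · apply smul_right_injective _ two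
    change (2 : ℂ) • T N = (2 : ℂ) • (r : ℂ) • N
    rw [← map_smul, smul_comm, h2, map_sub, hQ, h, ← smul_sub]

omit [DecidableEq n] in
theorem exists_isHermitian_eigen (hT : IsSelfAdjointPositive T) {r : ℝ} {Y : Matrix n n ℂ}
    (hY : T Y = (r : ℂ) • Y) : ∃ H K : Matrix n n ℂ, H.IsHermitian ∧ K.IsHermitian ∧
      Y = H + Complex.I • K ∧ T H = (r : ℂ) • H ∧ T K = (r : ℂ) • K := by
  have hYs : T Yᴴ = (r : ℂ) • Yᴴ := by
    rw [hT.map_conjTranspose, hY, conjTranspose_smul]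
    simp
  have hI : Complex.I * (-(1 / 2) * Complex.I) = 1 / 2 := by
    linear_combination (-1 / 2) * Complex.I_mul_I
  refine ⟨(1 / 2 : ℂ) • (Y + Yᴴ), (-(1 / 2) * Complex.I : ℂ) • (Y - Yᴴ), ?_, ?_, ?_, ?_, ?_⟩
  · simp [IsHermitian, conjTranspose_smul, add_comm]
  · simp only [IsHermitian, conjTranspose_smul, conjTranspose_sub, conjTranspose_conjTranspose]
    rw [← neg_sub Y, smul_neg, ← neg_smul]
    simp
  · rw [smul_smul, hI, ← smul_add]
    rw [add_add_sub_cancel, ← two_smul ℂ Y, smul_smul]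
    norm_num
  · rw [map_smul, map_add, hY, hYs, ← smul_add, smul_comm]
  · rw [map_smul, map_sub, hY, hYs, ← smul_sub, smul_comm]

/-- A nonzero self-adjoint positive map has a positive semidefinite eigenvector for its largest
eigenvalue. -/
theorem exists_posSemidef_eigenvector (hT : IsSelfAdjointPositive T) (h0 : T ≠ 0) :
    ∃ r : ℝ, 0 < r ∧ IsTopValue T r ∧
      ∃ X : Matrix n n ℂ, X.PosSemidef ∧ X ≠ 0 ∧ T X = (r : ℂ) • X := by
  obtain ⟨r, hr, htop, Y, hY0, hY⟩ := hT.exists_isTopValue h0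
  refine ⟨r, hr, htop, ?_⟩
  have key : ∀ H : Matrix n n ℂ, H.IsHermitian → H ≠ 0 → T H = (r : ℂ) • H →
      ∃ X : Matrix n n ℂ, X.PosSemidef ∧ X ≠ 0 ∧ T X = (r : ℂ) • X := by
    intro H hH hH0 hTH
    obtain ⟨P, N, hP, hN, rfl, hPN⟩ := exists_posSemidef_sub hH
    obtain ⟨h1, h2⟩ := hT.eigen_of_mul_eq_zero htop hP hN hPN hTH
    by_cases hP0 : P = 0
    · refine ⟨N, hN, ?_, h2⟩
      rintro rfl
      simp [hP0] at hH0
    · exact ⟨P, hP, hP0, h1⟩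
  obtain ⟨H, K, hH, hK, rfl, h1, h2⟩ := hT.exists_isHermitian_eigen hY
  by_cases hH0 : H = 0
  · refine key K hK ?_ h2
    rintro rfl
    simp [hH0] at hY0
  · exact key H hH hH0 h1

/-- The support of a positive semidefinite eigenvector is invariant. -/
theorem leavesInvariant_support (hT : IsSelfAdjointPositive T) {X V D : Matrix n n ℂ}
    (hX : X.PosSemidef) (hV : IsSupport V X D) {c : ℂ} (hTX : T X = c • X) :
    LeavesInvariant T (corner V) := by
  have hVp := hV.isStarProjection
  have hQ : (1 - V).PosSemidef := IsStarProjection.posSemidef hVp.one_sub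
  have hVh : Vᴴ = V := hVp.isSelfAdjoint
  -- By self-adjointness `tr (X T(1 - V)) = c tr (X (1 - V)) = 0`, and both factors are positive
  -- semidefinite.
  have h1 : X * T (1 - V) = 0 := by
    refine mul_eq_zero_of_trace_mul_eq_zero hX (hT.posSemidef _ hQ) ?_
    rw [← hT.trace_mul, hTX, smul_mul, mul_sub, hV.mul_right]
    simp
  have h2 : V * T (1 - V) = 0 := by
    calc V * T (1 - V) = D * X * T (1 - V) := by rw [← hV.eq_mul']
      _ = 0 := by rw [mul_assoc, h1, mul_zero]
  -- Invariance is recast as a linear identity so that it need only be tested on positive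
  -- semidefinite matrices. There `T (V A V)` has trace zero against `1 - V`, by the orthogonality
  -- just found.
  have h3 : (T ∘ₗ compression V - compression V ∘ₗ T ∘ₗ compression V) = 0 := by
    refine eq_zero_of_posSemidef _ fun A hA => ?_
    have hB : (V * A * V).PosSemidef := by
      have := hA.mul_mul_conjTranspose_same V
      rwa [hVh] at this
    have hTB := hT.posSemidef _ hB
    have h4 : T (V * A * V) * (1 - V) = 0 := by
      refine mul_eq_zero_of_trace_mul_eq_zero hTB hQ ?_
      rw [hT.trace_mul, mul_assoc, h2, mul_zero, trace_zero]
    have h5 : T (V * A * V) * V = T (V * A * V) := by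
      rw [mul_sub, mul_one, sub_eq_zero] at h4
      exact h4.symm
    have h6 : V * T (V * A * V) = T (V * A * V) := by
      have := congrArg conjTranspose h5
      rwa [conjTranspose_mul, hTB.isHermitian.eq, hVh] at this
    change T (V * A * V) - V * T (V * A * V) * V = 0
    rw [h6, h5, sub_self]
  rintro _ ⟨A, rfl⟩
  refine ⟨T (V * A * V), ?_⟩
  have := LinearMap.congr_fun h3 A
  exact sub_eq_zero.1 this

/-- In an irreducible block, positive semidefinite eigenvectors have full support. -/
theorem exists_isSupport_of_isIrreducibleOn (hT : IsSelfAdjointPositive T) {V X : Matrix n n ℂ}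
    (hV : IsStarProjection V) (hirr : IsIrreducibleOn T V) (hX : X.PosSemidef) (hX0 : X ≠ 0)
    (hXV : X ∈ corner V) {c : ℂ} (hTX : T X = c • X) : ∃ D, IsSupport V X D := by
  obtain ⟨W, D, hW⟩ := exists_isSupport hX.isHermitian
  obtain ⟨h1, h2⟩ := (mem_corner hV).1 hXV
  have hle : corner W ≤ corner V := by
    refine (corner_le_iff hW.isStarProjection hV).2 ⟨?_, ?_⟩
    · rw [hW.eq_mul, ← mul_assoc, h1]
    · rw [hW.eq_mul', mul_assoc, h2]
  rcases hirr W hW.isStarProjection hle (hT.leavesInvariant_support hX hW hTX) with h | h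
  · exact absurd (by rw [← hW.mul_left, h, zero_mul]) hX0
  · exact ⟨D, h ▸ hW⟩

/-- A self-adjoint map commutes with the compression to an invariant corner. -/
theorem map_compression (hT : IsSelfAdjointPositive T) {W : Matrix n n ℂ}
    (hW : IsStarProjection W) (hinv : LeavesInvariant T (corner W)) (X : Matrix n n ℂ) :
    T (W * X * W) = W * T X * W := by
  have hi : ∀ A, W * T (W * A * W) * W = T (W * A * W) := fun A => by
    obtain ⟨h1, h2⟩ := (mem_corner hW).1 (hinv _ ⟨A, rfl⟩)
    rw [h1, h2]
  have htr : ∀ X Y : Matrix n n ℂ, (W * X * W * Y).trace = (X * (W * Y * W)).trace := fun X Y => by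
    rw [mul_assoc, mul_assoc, trace_mul_comm]
    simp only [mul_assoc]
  rw [Matrix.ext_iff_trace_mul_right]
  intro B
  calc (T (W * X * W) * B).trace = (W * T (W * X * W) * W * B).trace := by rw [hi]
    _ = (X * (W * T (W * B * W) * W)).trace := by rw [htr, hT.trace_mul, htr]
    _ = (W * T X * W * B).trace := by rw [hi, htr, hT.trace_mul]

end IsSelfAdjointPositive

/-- A matrix of full support defines a faithful functional on its corner: the trace condition gives
`X A = 0`, and multiplying by the generalized inverse gives `V A = 0`. -/
theorem eq_zero_of_trace_mul_support {V X D A : Matrix n n ℂ} (hX : X.PosSemidef)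
    (hV : IsSupport V X D) (hA : A.PosSemidef) (hVA : V * A = A) (h : (X * A).trace = 0) :
    A = 0 := by
  rw [← hVA, hV.eq_mul', mul_assoc, mul_eq_zero_of_trace_mul_eq_zero hX hA h, mul_zero]

namespace IsSelfAdjointPositive

variable {T : Matrix n n ℂ →ₗ[ℂ] Matrix n n ℂ}

theorem compression_ne_zero {V : Matrix n n ℂ} (hV : IsStarProjection V)
    (hinv : LeavesInvariant T (corner V)) (hne : ∃ Y ∈ corner V, T Y ≠ 0) :
    compression V ∘ₗ T ∘ₗ compression V ≠ 0 := by
  intro h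
  obtain ⟨Y, hY, hTY⟩ := hne
  obtain ⟨h1, h2⟩ := (mem_corner hV).1 hY
  obtain ⟨h3, h4⟩ := (mem_corner hV).1 (hinv Y hY)
  have : V * T (V * Y * V) * V = 0 := LinearMap.congr_fun h Y
  rw [h1, h2, h3, h4] at this
  exact hTY this

/-- An eigenvector with nonzero eigenvalue lies in the range of the compressed map, hence in the
corner, where that map agrees with `T`. -/
theorem eigen_of_compression {V : Matrix n n ℂ} (hV : IsStarProjection V)
    (hinv : LeavesInvariant T (corner V)) {c : ℂ} (hc : c ≠ 0) {Z : Matrix n n ℂ}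
    (hZ : (compression V ∘ₗ T ∘ₗ compression V) Z = c • Z) : Z ∈ corner V ∧ T Z = c • Z := by
  replace hZ : V * T (V * Z * V) * V = c • Z := hZ
  have hZV : Z ∈ corner V := by
    refine ⟨c⁻¹ • T (V * Z * V), ?_⟩
    rw [Matrix.mul_smul, smul_mul, hZ, smul_smul, inv_mul_cancel₀ hc, one_smul]
  refine ⟨hZV, ?_⟩
  obtain ⟨h1, h2⟩ := (mem_corner hV).1 hZV
  obtain ⟨h3, h4⟩ := (mem_corner hV).1 (hinv Z hZV)
  rw [← hZ, h1, h2, h3, h4]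

/-- Perron–Frobenius for an irreducible block on which `T` does not vanish: the largest eigenvalue
of the compressed map is simple, with an eigenvector of full support. -/
theorem exists_perron (hT : IsSelfAdjointPositive T) {V : Matrix n n ℂ} (hV : IsStarProjection V)
    (hinv : LeavesInvariant T (corner V)) (hirr : IsIrreducibleOn T V)
    (hne : ∃ Y ∈ corner V, T Y ≠ 0) :
    ∃ (r : ℝ) (X D : Matrix n n ℂ), 0 < r ∧ X.PosSemidef ∧ IsSupport V X D ∧ T X = (r : ℂ) • X ∧
      IsTopValue (compression V ∘ₗ T ∘ₗ compression V) r ∧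
      ∀ Y, (compression V ∘ₗ T ∘ₗ compression V) Y = (r : ℂ) • Y → ∃ c : ℂ, Y = c • X := by
  have hVh : Vᴴ = V := hV.isSelfAdjoint
  have hT' := hT.compress hVh
  have h0 := compression_ne_zero hV hinv hne
  set T' := compression V ∘ₗ T ∘ₗ compression V
  obtain ⟨r, hr, htop, X, hX, hX0, hTX⟩ := hT'.exists_posSemidef_eigenvector h0
  have hrc : (r : ℂ) ≠ 0 := by exact_mod_cast hr.ne'
  have hmem : ∀ Z, T' Z = (r : ℂ) • Z → Z ∈ corner V ∧ T Z = (r : ℂ) • Z :=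
    fun Z hZ => eigen_of_compression hV hinv hrc hZ
  obtain ⟨hXV, hTX1⟩ := hmem X hTX
  obtain ⟨D, hD⟩ := hT.exists_isSupport_of_isIrreducibleOn hV hirr hX hX0 hXV hTX1
  refine ⟨r, X, D, hr, hX, hD, hTX1, htop, ?_⟩
  -- The positive and negative parts of `Z` are both eigenvectors. If both were nonzero,
  -- irreducibility would give both full support, against `P N = 0`. So `Z` has a sign, and then `tr
  -- (X Z) = 0` makes it vanish.
  have hzero : ∀ Z : Matrix n n ℂ, Z.IsHermitian → T' Z = (r : ℂ) • Z → (X * Z).trace = 0 →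
      Z = 0 := by
    intro Z hZ hTZ htr
    obtain ⟨P, N, hP, hN, rfl, hPN⟩ := exists_posSemidef_sub hZ
    obtain ⟨hTP, hTN⟩ := hT'.eigen_of_mul_eq_zero htop hP hN hPN hTZ
    obtain ⟨hPV, hTP1⟩ := hmem P hTP
    obtain ⟨hNV, hTN1⟩ := hmem N hTN
    have hVP := ((mem_corner hV).1 hPV).1
    have hVN := ((mem_corner hV).1 hNV).1
    by_cases hP0 : P = 0
    · subst hP0
      rw [zero_sub, mul_neg, trace_neg, neg_eq_zero] at htr
      rw [eq_zero_of_trace_mul_support hX hD hN hVN htr, sub_zero]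
    · obtain ⟨E, hE⟩ := hT.exists_isSupport_of_isIrreducibleOn hV hirr hP hP0 hPV hTP1
      have hN0 : N = 0 := by rw [← hVN, hE.eq_mul', mul_assoc, hPN, mul_zero]
      subst hN0
      rw [sub_zero] at htr
      exact absurd (eq_zero_of_trace_mul_support hX hD hP hVP htr) hP0
  have hXX : (X * X).trace ≠ 0 := by
    intro h
    refine hX0 (trace_mul_conjTranspose_self_eq_zero_iff.1 ?_)
    rw [hX.isHermitian.eq, h]
  have hreal : ∀ H : Matrix n n ℂ, H.IsHermitian → star (X * H).trace = (X * H).trace := by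
    intro H hH
    rw [← trace_conjTranspose, conjTranspose_mul, hX.isHermitian.eq, hH.eq, trace_mul_comm]
  have hherm : ∀ H : Matrix n n ℂ, H.IsHermitian → T' H = (r : ℂ) • H → ∃ c : ℂ, H = c • X := by
    intro H hH hTH
    -- The coefficient of the projection onto `X` is real, so the difference is still Hermitian.
    refine ⟨(X * H).trace / (X * X).trace, sub_eq_zero.1 (hzero _ ?_ ?_ ?_)⟩
    · rw [IsHermitian, conjTranspose_sub, conjTranspose_smul, hH.eq, hX.isHermitian.eq, star_div₀,
        hreal H hH, hreal X hX.isHermitian]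
    · rw [map_sub, map_smul, hTH, hTX, smul_sub, smul_comm]
    · rw [mul_sub, trace_sub, Matrix.mul_smul, trace_smul, smul_eq_mul, div_mul_cancel₀ _ hXX, sub_self]
  intro Y hY
  obtain ⟨H, K, hH, hK, rfl, h1, h2⟩ := hT'.exists_isHermitian_eigen hY
  obtain ⟨c, rfl⟩ := hherm H hH h1
  obtain ⟨d, rfl⟩ := hherm K hK h2
  exact ⟨c + Complex.I * d, by rw [add_smul, mul_smul]⟩

/-- A simple eigenvalue with an eigenvector of full support forces irreducibility. -/
theorem isIrreducibleOn_of_simple (hT : IsSelfAdjointPositive T) {V X D : Matrix n n ℂ} {c : ℂ}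
    (hX : X.PosSemidef) (hV : IsSupport V X D) (hTX : T X = c • X)
    (hsimple : ∀ Y ∈ corner V, T Y = c • Y → ∃ d : ℂ, Y = d • X) : IsIrreducibleOn T V := by
  intro W hW hle hinv
  obtain ⟨hVW, hWV⟩ := (corner_le_iff hW hV.isStarProjection).1 hle
  have hWW : W * W = W := hW.isIdempotentElem.eq
  -- `T` commutes with compression to the invariant corner of `W`, so `W X W` is again an
  -- eigenvector and equals `d X`. If `d = 0`, then `tr (X W) = 0` and `W = 0`; otherwise `W X = X`,
  -- and `W` contains the support of `X`.
  obtain ⟨d, hd⟩ := hsimple (W * X * W) (hle ⟨X, rfl⟩) (by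
    rw [hT.map_compression hW hinv, hTX, Matrix.mul_smul, smul_mul])
  by_cases hd0 : d = 0
  · left
    refine eq_zero_of_trace_mul_support hX hV (IsStarProjection.posSemidef hW) hVW ?_
    have : (W * X * W).trace = 0 := by rw [hd, hd0, zero_smul, trace_zero]
    rwa [mul_assoc, trace_mul_comm, mul_assoc, hWW] at this
  · right
    have hXd : X = d⁻¹ • (W * X * W) := by rw [hd, smul_smul, inv_mul_cancel₀ hd0, one_smul]
    have hWX : W * X = X := by
      rw [hXd, Matrix.mul_smul, ← mul_assoc, ← mul_assoc, hWW]
    calc W = W * V := hWV.symm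
      _ = V := by rw [hV.eq_mul, ← mul_assoc, hWX]

end IsSelfAdjointPositive

end Perron

/-! ### Complete reducibility and the decomposition property. -/

section Blocks

variable {n : Type*} [Fintype n] [DecidableEq n]

/-- A decomposition of `T` into irreducible blocks on which `T` does not vanish. -/
structure IsBlockSystem {ι : Type*} [Fintype ι] (T : Matrix n n ℂ →ₗ[ℂ] Matrix n n ℂ)
    (W : ι → Matrix n n ℂ) : Prop where
  isStarProjection : ∀ i, IsStarProjection (W i)
  mul_eq_zero : ∀ i j, i ≠ j → W i * W j = 0
  leavesInvariant : ∀ i, LeavesInvariant T (corner (W i))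
  isIrreducibleOn : ∀ i, IsIrreducibleOn T (W i)
  exists_ne_zero : ∀ i, ∃ Y ∈ corner (W i), T Y ≠ 0
  apply_eq_sum : ∀ Y, T Y = ∑ i, T (W i * Y * W i)

theorem sub_sum_mem_traceOrthogonal {ι : Type*} [Fintype ι] {W : ι → Matrix n n ℂ}
    (hW : ∀ i, IsStarProjection (W i)) (horth : ∀ i j, i ≠ j → W i * W j = 0)
    (X : Matrix n n ℂ) :
    X - ∑ i, W i * X * W i ∈ traceOrthogonal (⨆ i, corner (W i)) := by
  classical
  have hsa : ∀ i, (W i)ᴴ = W i := fun i => (hW i).isSelfAdjoint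
  intro Y hY
  induction hY using Submodule.iSup_induction' with
  | zero => simp
  | add A B _ _ hA hB => rw [conjTranspose_add, mul_add, trace_add, hA, hB, add_zero]
  | mem j A hA =>
    obtain ⟨h1, h2⟩ := (mem_corner (hW j)).1 hA
    have e1 : Aᴴ * W j = Aᴴ := by
      rw [← hsa j, ← conjTranspose_mul, h1]
    have e3 : W j * Aᴴ = Aᴴ := by
      rw [← hsa j, ← conjTranspose_mul, h2]
    have e2 : W j * (∑ i, W i * X * W i) * W j = W j * X * W j := by
      have hid := (hW j).isIdempotentElem.eq
      rw [Finset.mul_sum, Finset.sum_mul, Finset.sum_eq_single j]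
      · rw [← mul_assoc, ← mul_assoc, hid, mul_assoc, hid]
      · intro b _ hb
        rw [← mul_assoc, ← mul_assoc, horth j b hb.symm]
        simp
      · simp
    have e4 : ∀ B : Matrix n n ℂ, (B * Aᴴ).trace = (W j * B * W j * Aᴴ).trace := by
      intro B
      rw [mul_assoc (W j * B), e3, mul_assoc, trace_mul_comm (W j), mul_assoc, e1]
    rw [sub_mul, trace_sub, e4 X, e4 (∑ i, W i * X * W i), e2, sub_self]

/-- Blocks on which `T` vanishes contribute nothing to `T Y` and are discarded, so that every
remaining block has a positive Perron eigenvalue. -/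
theorem IsCompletelyReducibleMap.exists_isBlockSystem {T : Matrix n n ℂ →ₗ[ℂ] Matrix n n ℂ}
    (h : IsCompletelyReducibleMap T) :
    ∃ (ι : Type) (_ : Fintype ι) (W : ι → Matrix n n ℂ), IsBlockSystem T W := by
  classical
  obtain ⟨l, W, hW, horth, -, -, hinv, hirr, hR⟩ := h
  refine ⟨{i : Fin l // ∃ Y ∈ corner (W i), T Y ≠ 0}, inferInstance, fun i => W i,
    fun i => hW i, fun i j hij => horth i j fun e => hij (Subtype.ext e), fun i => hinv i,
    fun i => hirr i, fun i => i.2, fun Y => ?_⟩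
  have h1 := hR _ (sub_sum_mem_traceOrthogonal hW horth Y)
  rw [map_sub, map_sum, sub_eq_zero] at h1
  rw [h1, ← Finset.sum_filter_of_ne (p := fun i => ∃ Y ∈ corner (W i), T Y ≠ 0)]
  · exact Finset.sum_subtype _ (by simp) _
  · intro i _ hi
    exact ⟨_, ⟨Y, rfl⟩, hi⟩

theorem IsBlockSystem.isCompletelyReducibleMap {ι : Type*} [Fintype ι]
    {T : Matrix n n ℂ →ₗ[ℂ] Matrix n n ℂ} {W : ι → Matrix n n ℂ} (h : IsBlockSystem T W) :
    IsCompletelyReducibleMap T := by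
  classical
  let e := (Fintype.equivFin ι).symm
  have hW : ∀ i, IsStarProjection (W (e i)) := fun i => h.isStarProjection _
  have horth : ∀ i j, i ≠ j → W (e i) * W (e j) = 0 :=
    fun i j hij => h.mul_eq_zero _ _ (e.injective.ne hij)
  refine ⟨Fintype.card ι, fun i => W (e i), hW, horth, iSupIndep_corner hW horth,
    isCompl_corner hW horth, fun i => h.leavesInvariant _, fun i => h.isIrreducibleOn _, ?_⟩
  intro X hX
  rw [h.apply_eq_sum]
  refine Finset.sum_eq_zero fun i _ => ?_
  have hid := (h.isStarProjection i).isIdempotentElem.eq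
  have hsa : (W i)ᴴ = W i := (h.isStarProjection i).isSelfAdjoint
  have h1 : W i * X * W i = 0 := by
    rw [← trace_mul_conjTranspose_self_eq_zero_iff]
    have h2 := hX (W i * X * W i) (by
      refine (le_iSup (fun i => corner (W (e i))) (e.symm i)) ?_
      simp only [Equiv.apply_symm_apply]
      exact ⟨X, rfl⟩)
    have h3 : (W i * X * W i)ᴴ = W i * Xᴴ * W i := by
      simp [conjTranspose_mul, hsa, mul_assoc]
    rw [h3] at h2 ⊢
    rw [← h2, mul_assoc (W i * X), mul_assoc (W i), trace_mul_comm]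
    simp only [mul_assoc, hid]
    rw [← mul_assoc (W i) (W i), hid]
  rw [h1, map_zero]

/-- Supports of eigenvectors with positive eigenvalue reduce `T`. -/
def HasDecompositionProperty (T : Matrix n n ℂ →ₗ[ℂ] Matrix n n ℂ) : Prop :=
  ∀ (X V D : Matrix n n ℂ) (r : ℝ), X.PosSemidef → 0 < r → T X = (r : ℂ) • X →
    IsSupport V X D → ∀ A, T (V * A * (1 - V)) = 0

namespace IsSelfAdjointPositive

variable {T : Matrix n n ℂ →ₗ[ℂ] Matrix n n ℂ}

/-- The eigenvector is the sum of its compressions `W i X W i`. Each is zero or, by irreducibility,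
has support `W i`, so `W i V = 0` or `(1 - V) W i = 0`. Either way the compression of `V A (1 - V)`
to the block is zero. -/
theorem hasDecompositionProperty (hT : IsSelfAdjointPositive T) {ι : Type*} [Fintype ι]
    {W : ι → Matrix n n ℂ} (hW : IsBlockSystem T W) : HasDecompositionProperty T := by
  classical
  intro X V D r hX hr hTX hV A
  have hrc : (r : ℂ) ≠ 0 := by exact_mod_cast hr.ne'
  have hcomp : ∀ i Y, T (W i * Y * W i) = W i * T Y * W i :=
    fun i Y => hT.map_compression (hW.isStarProjection i) (hW.leavesInvariant i) Y
  have hXsum : X = ∑ i, W i * X * W i := by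
    have h1 := hW.apply_eq_sum X
    simp only [hcomp, hTX, Matrix.mul_smul, smul_mul] at h1
    rw [← Finset.smul_sum] at h1
    exact smul_right_injective _ hrc h1
  have hWX : ∀ i, W i * X = W i * X * W i := by
    intro i
    conv_lhs => rw [hXsum, Finset.mul_sum]
    rw [Finset.sum_eq_single i]
    · rw [← mul_assoc, ← mul_assoc, (hW.isStarProjection i).isIdempotentElem.eq]
    · intro j _ hj
      rw [← mul_assoc, ← mul_assoc, hW.mul_eq_zero i j hj.symm]
      simp
    · simp
  have hXW : ∀ i, X * W i = W i * X * W i := by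
    intro i
    have hsa : (W i)ᴴ = W i := (hW.isStarProjection i).isSelfAdjoint
    have := congrArg conjTranspose (hWX i)
    simpa [conjTranspose_mul, hsa, hX.isHermitian.eq, mul_assoc] using this
  rw [hW.apply_eq_sum]
  refine Finset.sum_eq_zero fun i _ => ?_
  have hp := hW.isStarProjection i
  have hsa : (W i)ᴴ = W i := hp.isSelfAdjoint
  have hXi : (W i * X * W i).PosSemidef := by
    have := hX.mul_mul_conjTranspose_same (W i)
    rwa [hsa] at this
  have hTXi : T (W i * X * W i) = (r : ℂ) • (W i * X * W i) := by
    rw [hcomp, hTX, Matrix.mul_smul, smul_mul]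
  suffices h : W i * (V * A * (1 - V)) * W i = 0 by rw [h, map_zero]
  by_cases h0 : W i * X * W i = 0
  · have : W i * V = 0 := by rw [hV.eq_mul, ← mul_assoc, hWX, h0, zero_mul]
    rw [← mul_assoc, ← mul_assoc, this]
    simp
  · obtain ⟨E, hE⟩ := hT.exists_isSupport_of_isIrreducibleOn hp (hW.isIrreducibleOn i) hXi h0
      ⟨X, rfl⟩ hTXi
    have h2 : (1 - V) * W i = 0 := by
      calc (1 - V) * W i = (1 - V) * (W i * X * W i * E) := by rw [← hE.eq_mul]
        _ = (X - V * X) * W i * E := by rw [← hXW]; noncomm_ring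
        _ = 0 := by rw [hV.mul_left, sub_self, zero_mul, zero_mul]
    rw [mul_assoc, mul_assoc (V * A), h2, mul_zero, mul_zero]

/-- The off-diagonal blocks are killed on both sides. -/
theorem apply_off_diagonal (hT : IsSelfAdjointPositive T) {V : Matrix n n ℂ}
    (hV : IsStarProjection V) (h : ∀ A, T (V * A * (1 - V)) = 0) (A : Matrix n n ℂ) :
    T ((1 - V) * A * V) = 0 := by
  have hsa : Vᴴ = V := hV.isSelfAdjoint
  have h1 := hT.map_conjTranspose (V * Aᴴ * (1 - V))
  rw [h, conjTranspose_zero] at h1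
  rw [← h1]
  simp [conjTranspose_mul, hsa, mul_assoc]

/-- If `V` reduces `T`, then the complementary corner is invariant. -/
theorem leavesInvariant_one_sub (hT : IsSelfAdjointPositive T) {V : Matrix n n ℂ}
    (hV : IsStarProjection V) (hinv : LeavesInvariant T (corner V))
    (h : ∀ A, T (V * A * (1 - V)) = 0) : LeavesInvariant T (corner (1 - V)) := by
  have h' := hT.apply_off_diagonal hV h
  have hVV : V * V = V := hV.isIdempotentElem.eq
  intro Z hZ
  obtain ⟨h1, h2⟩ := (mem_corner hV.one_sub).1 hZ
  have hVT : ∀ B, Z * T (V * B * V) = 0 := by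
    intro B
    obtain ⟨h3, h4⟩ := (mem_corner hV).1 (hinv _ ⟨B, rfl⟩)
    rw [← h2, ← h3, mul_assoc, ← mul_assoc (1 - V), sub_mul, one_mul, hVV]
    simp
  -- Pairing with `B` and moving `T` across leaves `tr (Z T (B V))`. The off-diagonal part of `B V`
  -- is killed by `T`, and the diagonal part is sent into the corner of `V`, which `Z` annihilates.
  have e1 : V * T Z = 0 := by
    rw [Matrix.ext_iff_trace_mul_right]
    intro B
    have : B * V = V * B * V + (1 - V) * B * V := by noncomm_ring
    rw [zero_mul, trace_zero, mul_assoc, trace_mul_comm, mul_assoc, hT.trace_mul, this, map_add, h',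
      add_zero, hVT, trace_zero]
  have e2 : T Z * V = 0 := by
    rw [Matrix.ext_iff_trace_mul_right]
    intro B
    have : V * B = V * B * V + V * B * (1 - V) := by noncomm_ring
    rw [zero_mul, trace_zero, mul_assoc, hT.trace_mul, this, map_add, h,
      add_zero, hVT, trace_zero]
  refine (mem_corner hV.one_sub).2 ⟨?_, ?_⟩
  · rw [sub_mul, e1, one_mul, sub_zero]
  · rw [mul_sub, e2, mul_one, sub_zero]

/-- Choose the eigenvector of minimal support, that is, with maximal left annihilator. A nonzero
invariant corner inside the support cannot be killed by `T`, by faithfulness of `X`, so it carries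
another such eigenvector `X'`. By maximality `X` and `X'` have the same annihilator; `1 - W` belongs
to it, so `W` is the whole support. -/
theorem exists_irreducible_support (hT : IsSelfAdjointPositive T) (h0 : T ≠ 0) :
    ∃ (r : ℝ) (X V D : Matrix n n ℂ), 0 < r ∧ X.PosSemidef ∧ X ≠ 0 ∧ T X = (r : ℂ) • X ∧
      IsSupport V X D ∧ IsIrreducibleOn T V := by
  let S : Set (Submodule ℂ (Matrix n n ℂ)) := {M | ∃ (r : ℝ) (X : Matrix n n ℂ), 0 < r ∧
    X.PosSemidef ∧ X ≠ 0 ∧ T X = (r : ℂ) • X ∧ M = LinearMap.ker (LinearMap.mulRight ℂ X)}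
  have hS : S.Nonempty := by
    obtain ⟨r, hr, -, X, hX, hX0, hTX⟩ := hT.exists_posSemidef_eigenvector h0
    exact ⟨_, r, X, hr, hX, hX0, hTX, rfl⟩
  obtain ⟨_, ⟨r, X, hr, hX, hX0, hTX, rfl⟩, hmax⟩ :=
    (wellFounded_gt (α := Submodule ℂ (Matrix n n ℂ))).has_min S hS
  obtain ⟨V, D, hV⟩ := exists_isSupport hX.isHermitian
  refine ⟨r, X, V, D, hr, hX, hX0, hTX, hV, ?_⟩
  intro W hW hle hinv
  by_cases hW0 : W = 0
  · exact Or.inl hW0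
  right
  have hrc : (r : ℂ) ≠ 0 := by exact_mod_cast hr.ne'
  obtain ⟨hVW, hWV⟩ := (corner_le_iff hW hV.isStarProjection).1 hle
  have hne : ∃ Y ∈ corner W, T Y ≠ 0 := by
    by_contra hcon
    push Not at hcon
    have hTW : T W = 0 := hcon W ⟨1, by rw [mul_one, hW.isIdempotentElem.eq]⟩
    refine hW0 (eq_zero_of_trace_mul_support hX hV (IsStarProjection.posSemidef hW) hVW ?_)
    have h1 := hT.trace_mul X W
    rw [hTW, mul_zero, trace_zero, hTX, smul_mul, trace_smul, smul_eq_mul] at h1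
    exact (mul_eq_zero.1 h1).resolve_left hrc
  obtain ⟨r', hr', -, X', hX', hX'0, hTX'⟩ :=
    (hT.compress hW.isSelfAdjoint).exists_posSemidef_eigenvector (compression_ne_zero hW hinv hne)
  obtain ⟨hX'W, hTX'1⟩ := eigen_of_compression hW hinv (by exact_mod_cast hr'.ne') hTX'
  have hWX' := ((mem_corner hW).1 hX'W).1
  have hVX' := ((mem_corner hV.isStarProjection).1 (hle hX'W)).1
  have hker : LinearMap.ker (LinearMap.mulRight ℂ X) ≤ LinearMap.ker (LinearMap.mulRight ℂ X') := by
    intro A hA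
    replace hA : A * X = 0 := hA
    change A * X' = 0
    rw [← hVX', hV.eq_mul, ← mul_assoc, ← mul_assoc, hA]
    simp
  have heq := eq_of_le_of_not_lt hker (hmax _ ⟨r', X', hr', hX', hX'0, hTX'1, rfl⟩)
  have hmem : (1 - W) ∈ LinearMap.ker (LinearMap.mulRight ℂ X) := by
    rw [heq]
    change (1 - W) * X' = 0
    rw [sub_mul, one_mul, hWX', sub_self]
  replace hmem : (1 - W) * X = 0 := hmem
  have hV1 : (1 - W) * V = 0 := by rw [hV.eq_mul, ← mul_assoc, hmem, zero_mul]
  rw [sub_mul, one_mul, hWV, sub_eq_zero] at hV1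
  exact hV1.symm

/-- The decomposition property implies complete reducibility. -/
theorem exists_isBlockSystem (hT : IsSelfAdjointPositive T) (hdec : HasDecompositionProperty T) :
    ∃ (ι : Type) (_ : Fintype ι) (W : ι → Matrix n n ℂ), IsBlockSystem T W := by
  -- Induction on the rank of `T`: a minimal support is split off and the compression to its
  -- complement is treated next.
  induction hN : Module.finrank ℂ (LinearMap.range T) using Nat.strong_induction_on
    generalizing T with
  | _ N ih =>
  by_cases h0 : T = 0
  · exact ⟨Fin 0, inferInstance, fun i => 0, fun i => i.elim0, fun i => i.elim0, fun i => i.elim0,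
      fun i => i.elim0, fun i => i.elim0, fun Y => by simp [h0]⟩
  obtain ⟨r, X, V, D, hr, hX, hX0, hTX, hV, hirr⟩ := hT.exists_irreducible_support h0
  have hrc : (r : ℂ) ≠ 0 := by exact_mod_cast hr.ne'
  have hp := hV.isStarProjection
  have hVV : V * V = V := hp.isIdempotentElem.eq
  have hinv := hT.leavesInvariant_support hX hV hTX
  have hoff := hdec X V D r hX hr hTX hV
  have hoff' := hT.apply_off_diagonal hp hoff
  have hinvQ := hT.leavesInvariant_one_sub hp hinv hoff
  obtain ⟨Q, hQ⟩ : ∃ Q, Q = 1 - V := ⟨_, rfl⟩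
  rw [← hQ] at hoff hoff' hinvQ
  have hpQ : IsStarProjection Q := hQ ▸ hp.one_sub
  have hQQ : Q * Q = Q := hpQ.isIdempotentElem.eq
  have hQV : Q * V = 0 := by rw [hQ, sub_mul, one_mul, hVV, sub_self]
  have hVQ : V * Q = 0 := by rw [hQ, mul_sub, mul_one, hVV, sub_self]
  have hT' : IsSelfAdjointPositive (compression Q ∘ₗ T ∘ₗ compression Q) :=
    hT.compress hpQ.isSelfAdjoint
  obtain ⟨T', hT'def⟩ : ∃ T', T' = compression Q ∘ₗ T ∘ₗ compression Q := ⟨_, rfl⟩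
  have hT'a : ∀ A, T' A = T (Q * A * Q) := by
    intro A
    obtain ⟨h1, h2⟩ := (mem_corner hpQ).1 (hinvQ _ ⟨A, rfl⟩)
    rw [hT'def]
    change Q * T (Q * A * Q) * Q = _
    rw [h1, h2]
  have hT'Q : ∀ A ∈ corner Q, T' A = T A := by
    intro A hA
    obtain ⟨h1, h2⟩ := (mem_corner hpQ).1 hA
    rw [hT'a, h1, h2]
  have heig : ∀ (c : ℂ) (Z : Matrix n n ℂ), c ≠ 0 → T' Z = c • Z → Z ∈ corner Q ∧ T Z = c • Z :=
    fun c Z hc hZ => eigen_of_compression hpQ hinvQ hc (hT'def ▸ hZ)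
  rw [← hT'def] at hT'
  have hsplit : ∀ A, T A = T (V * A * V) + T' A := by
    intro A
    have : A = V * A * V + V * A * Q + Q * A * V + Q * A * Q := by rw [hQ]; noncomm_ring
    conv_lhs => rw [this]
    rw [map_add, map_add, map_add, hoff, hoff', hT'a, add_zero, add_zero]
  -- An eigenvector of `T'` with positive eigenvalue lies in the corner of `Q`, so it is an
  -- eigenvector of `T` with the same support.
  have hdec' : HasDecompositionProperty T' := by
    intro X' V' D' r' hX' hr' hTX' hV' A
    obtain ⟨hmem, hTX1⟩ := heig r' X' (by exact_mod_cast hr'.ne') hTX'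
    obtain ⟨h1, h2⟩ := (mem_corner hpQ).1 hmem
    have h3 : Q * V' = V' := by rw [hV'.eq_mul, ← mul_assoc, h1]
    have h4 : V' * Q = V' := by rw [hV'.eq_mul', mul_assoc, h2]
    have h5 : Q * (V' * A * (1 - V')) * Q = V' * (A * Q) * (1 - V') := by
      have h6 : (1 - V') * Q = Q * (1 - V') := by rw [sub_mul, mul_sub, h3, h4, one_mul, mul_one]
      rw [← mul_assoc, ← mul_assoc, h3, mul_assoc, h6]
      simp only [mul_assoc]
    rw [hT'a, h5]
    exact hdec X' V' D' r' hX' hr' hTX1 hV' _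
  have hlt : Module.finrank ℂ (LinearMap.range T') < N := by
    rw [← hN]
    refine Submodule.finrank_lt_finrank_of_lt (lt_of_le_of_ne ?_ ?_)
    · rintro _ ⟨A, rfl⟩
      exact ⟨_, (hT'a A).symm⟩
    -- The rank drops: `X` is in the range of `T`, but the range of `T'` lies in the corner of `Q`,
    -- and `Q X = 0`.
    · intro h
      have hXr : X ∈ LinearMap.range T := ⟨(r : ℂ)⁻¹ • X, by
        rw [map_smul, hTX, smul_smul, inv_mul_cancel₀ hrc, one_smul]⟩
      rw [← h] at hXr
      obtain ⟨A, hA⟩ := hXr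
      obtain ⟨h1, h2⟩ := (mem_corner hpQ).1 (hinvQ _ ⟨A, rfl⟩)
      rw [hT'a] at hA
      rw [hA] at h1
      rw [hQ, sub_mul, one_mul, hV.mul_left, sub_self] at h1
      exact hX0 h1.symm
  obtain ⟨ι, hι, W, hW⟩ := ih _ hlt hT' hdec' rfl
  -- Nonvanishing of the blocks is used here: each `W i` is the support of a Perron eigenvector with
  -- positive eigenvalue, which must lie in the corner of `Q`.
  have hWQ : ∀ i, Q * W i = W i ∧ W i * Q = W i := by
    intro i
    obtain ⟨c, Xi, Di, hc, hXi, hWi, hTXi, -⟩ := hT'.exists_perron (hW.isStarProjection i)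
      (hW.leavesInvariant i) (hW.isIrreducibleOn i) (hW.exists_ne_zero i)
    obtain ⟨h1, h2⟩ := (mem_corner hpQ).1 (heig c Xi (by exact_mod_cast hc.ne') hTXi).1
    exact ⟨by rw [hWi.eq_mul, ← mul_assoc, h1], by rw [hWi.eq_mul', mul_assoc, h2]⟩
  have hle : ∀ i, corner (W i) ≤ corner Q := fun i =>
    (corner_le_iff (hW.isStarProjection i) hpQ).2 (hWQ i)
  refine ⟨Option ι, inferInstance, fun o => o.elim V W, ?_, ?_, ?_, ?_, ?_, ?_⟩
  · rintro (_ | i)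
    · exact hp
    · exact hW.isStarProjection i
  · rintro (_ | i) (_ | j) hij
    · exact absurd rfl hij
    · change V * W j = 0
      rw [← (hWQ j).1, ← mul_assoc, hVQ, zero_mul]
    · change W i * V = 0
      rw [← (hWQ i).2, mul_assoc, hQV, mul_zero]
    · exact hW.mul_eq_zero i j fun h => hij (h ▸ rfl)
  · rintro (_ | i)
    · exact hinv
    · intro Z hZ
      rw [← hT'Q Z (hle i hZ)]
      exact hW.leavesInvariant i Z hZ
  · rintro (_ | i)
    · exact hirr
    · intro U hU hUle hUinv
      refine hW.isIrreducibleOn i U hU hUle fun Z hZ => ?_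
      rw [hT'Q Z (hle i (hUle hZ))]
      exact hUinv Z hZ
  · rintro (_ | i)
    · refine ⟨X, (mem_corner hp).2 ⟨hV.mul_left, hV.mul_right⟩, ?_⟩
      rw [hTX]
      exact smul_ne_zero hrc hX0
    · obtain ⟨Y, hY, hne⟩ := hW.exists_ne_zero i
      refine ⟨Y, hY, ?_⟩
      rwa [← hT'Q Y (hle i hY)]
  · intro Y
    rw [Fintype.sum_option, hsplit, hW.apply_eq_sum]
    change _ = T (V * Y * V) + ∑ i, T (W i * Y * W i)
    congr 1
    exact Finset.sum_congr rfl fun i _ => hT'Q _ (hle i ⟨Y, rfl⟩)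

end IsSelfAdjointPositive

end Blocks

/-! ### Reordering of iterated finite sums. -/

section Rearrange

variable {α α' β β' δ E : Type*} [Fintype α] [Fintype α'] [Fintype β] [Fintype β'] [Fintype δ]
  [AddCommMonoid E]

theorem sum_rearrange₄ (f : β → β' → α → α' → E) :
    ∑ b, ∑ b', ∑ a, ∑ a', f b b' a a' = ∑ a, ∑ a', ∑ b, ∑ b', f b b' a a' := by
  have h : ∑ p : β × β', ∑ q : α × α', f p.1 p.2 q.1 q.2 =
      ∑ q : α × α', ∑ p : β × β', f p.1 p.2 q.1 q.2 := Finset.sum_comm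
  simpa only [Fintype.sum_prod_type] using h

theorem sum_rearrange₅ (f : β → β' → α → α' → δ → E) :
    ∑ b, ∑ b', ∑ a, ∑ a', ∑ c, f b b' a a' c = ∑ c, ∑ a, ∑ b, ∑ a', ∑ b', f b b' a a' c := by
  let e : β × β' × α × α' × δ ≃ δ × α × β × α' × β' :=
    { toFun := fun ⟨b, b', a, a', c⟩ => ⟨c, a, b, a', b'⟩
      invFun := fun ⟨c, a, b, a', b'⟩ => ⟨b, b', a, a', c⟩
      left_inv := fun _ => rfl
      right_inv := fun _ => rfl }
  have h : ∑ p : β × β' × α × α' × δ, f p.1 p.2.1 p.2.2.1 p.2.2.2.1 p.2.2.2.2 =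
      ∑ q : δ × α × β × α' × β', f q.2.2.1 q.2.2.2.2 q.2.1 q.2.2.2.1 q.1 :=
    Fintype.sum_equiv e _ _ fun _ => rfl
  simpa only [Fintype.sum_prod_type] using h

end Rearrange

/-! ### The maps `F_γ` and `G_γ` of a state. -/

section StateMaps

variable {k m : Type*} [Fintype k] [Fintype m]

omit [Fintype k] in
theorem mapF_eq_mapG_submatrix (γ : Matrix (k × m) (k × m) ℂ) :
    mapF γ = mapG (γ.submatrix Prod.swap Prod.swap) := rfl

omit [Fintype m] in
theorem mapG_conjTranspose {γ : Matrix (k × m) (k × m) ℂ} (hγ : γ.IsHermitian)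
    (X : Matrix k k ℂ) : mapG γ Xᴴ = (mapG γ X)ᴴ := by
  ext b b'
  simp only [mapG, LinearMap.coe_mk, AddHom.coe_mk, of_apply, conjTranspose_apply, star_sum,
    star_mul', hγ.apply]
  exact Finset.sum_comm

/-- With `X = C* C`, the quadratic form of `G_γ X` at `v` is a sum over the rows of `C` of the form
of `γ` at the product vectors (conjugate row) ⊗ `v`. -/
theorem mapG_posSemidef {γ : Matrix (k × m) (k × m) ℂ} (hγ : γ.PosSemidef) {X : Matrix k k ℂ}
    (hX : X.PosSemidef) : (mapG γ X).PosSemidef := by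
  classical
  have hH : (mapG γ X).IsHermitian := by
    rw [IsHermitian, ← mapG_conjTranspose hγ.isHermitian, hX.isHermitian.eq]
  refine PosSemidef.of_dotProduct_mulVec_nonneg hH fun v => ?_
  obtain ⟨C, rfl⟩ := exists_eq_conjTranspose_mul_self hX
  have key : star v ⬝ᵥ (mapG γ (Cᴴ * C) *ᵥ v) =
      ∑ c, star (fun p : k × m => star (C c p.1) * v p.2) ⬝ᵥ
        (γ *ᵥ fun p : k × m => star (C c p.1) * v p.2) := by
    simp only [dotProduct, mulVec, mapG, LinearMap.coe_mk, AddHom.coe_mk, of_apply, mul_apply,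
      conjTranspose_apply, Pi.star_apply, star_mul', star_star, Finset.mul_sum, Finset.sum_mul,
      Fintype.sum_prod_type]
    rw [sum_rearrange₅]
    exact Finset.sum_congr rfl fun c _ => Finset.sum_congr rfl fun a _ =>
      Finset.sum_congr rfl fun b _ => Finset.sum_congr rfl fun a' _ =>
        Finset.sum_congr rfl fun b' _ => by ring
  rw [key]
  exact Finset.sum_nonneg fun c _ => hγ.dotProduct_mulVec_nonneg _

theorem trace_mapG_mul (γ : Matrix (k × m) (k × m) ℂ) (X : Matrix k k ℂ) (Y : Matrix m m ℂ) :
    (mapG γ X * Y).trace = (X * mapF γ Y).trace := by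
  simp only [trace, diag_apply, mul_apply, mapG, mapF, LinearMap.coe_mk, AddHom.coe_mk, of_apply,
    Finset.sum_mul, Finset.mul_sum]
  conv_rhs => rw [Finset.sum_comm]
  rw [sum_rearrange₄]
  exact Finset.sum_congr rfl fun a _ => Finset.sum_congr rfl fun a' _ =>
    Finset.sum_congr rfl fun b _ => Finset.sum_congr rfl fun b' _ => by ring

/-- `F_γ` is adjoint to `G_γ`, so the quadratic form of the composite at `X` is the squared norm of
`G_γ X`. -/
theorem isSelfAdjointPositive_comp {γ : Matrix (k × m) (k × m) ℂ} (hγ : γ.PosSemidef) :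
    IsSelfAdjointPositive (mapF γ ∘ₗ mapG γ) := by
  have hγ' : (γ.submatrix Prod.swap Prod.swap).PosSemidef := hγ.submatrix _
  have h1 : ∀ X Y, (mapF γ (mapG γ X) * Y).trace = (mapG γ X * mapG γ Y).trace := fun X Y => by
    rw [trace_mul_comm, ← trace_mapG_mul, trace_mul_comm]
  refine ⟨fun X hX => mapG_posSemidef hγ' (mapG_posSemidef hγ hX), fun X => ?_, fun X Y => ?_,
    fun X => ?_⟩
  · change mapF γ (mapG γ Xᴴ) = (mapF γ (mapG γ X))ᴴ
    rw [mapG_conjTranspose hγ.isHermitian, mapF_eq_mapG_submatrix,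
      mapG_conjTranspose hγ'.isHermitian]
  · change (mapF γ (mapG γ X) * Y).trace = (X * mapF γ (mapG γ Y)).trace
    rw [h1, trace_mapG_mul]
  · change 0 ≤ (mapF γ (mapG γ X) * Xᴴ).trace
    rw [h1, mapG_conjTranspose hγ.isHermitian]
    exact (posSemidef_self_mul_conjTranspose _).trace_nonneg

/-- If the composite vanishes, then so does the squared norm of every `G_γ X`; the entries of `γ`
are read off from `G_γ` on matrix units. -/
theorem comp_ne_zero [DecidableEq k] {γ : Matrix (k × m) (k × m) ℂ} (hγ : γ.IsHermitian)
    (h0 : γ ≠ 0) : mapF γ ∘ₗ mapG γ ≠ 0 := by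
  intro h
  have hG : ∀ X, mapG γ X = 0 := fun X => by
    rw [← trace_mul_conjTranspose_self_eq_zero_iff, ← mapG_conjTranspose hγ, trace_mul_comm,
      trace_mapG_mul, show mapF γ (mapG γ X) = 0 from LinearMap.congr_fun h X, mul_zero, trace_zero]
  refine h0 (Matrix.ext fun p q => ?_)
  have := congrFun (congrFun (hG (single q.1 p.1 1)) p.2) q.2
  simp only [mapG, LinearMap.coe_mk, AddHom.coe_mk, of_apply, single_apply] at this
  rw [Finset.sum_eq_single p.1, Finset.sum_eq_single q.1] at this
  · simpa using this
  · intro b _ hb; simp [hb.symm]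
  · simp
  · intro b _ hb; simp [hb.symm]
  · simp

end StateMaps

/-! ### Tensor products of matrices. -/

section Tensor

variable {σ : Type*} [Fintype σ] {k : σ → Type*}

theorem tensor_conjTranspose (A : ∀ i, Matrix (k i) (k i) ℂ) :
    (tensor A)ᴴ = tensor fun i => (A i)ᴴ := by
  ext a a'
  simp [tensor]

theorem exists_eq_zero_of_tensor_eq_zero {A : ∀ i, Matrix (k i) (k i) ℂ} (h : tensor A = 0) :
    ∃ i, A i = 0 := by
  by_contra hcon
  push Not at hcon
  have : ∀ i, ∃ a a', A i a a' ≠ 0 := by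
    intro i
    by_contra h'
    push Not at h'
    exact hcon i (Matrix.ext h')
  choose a a' ha using this
  exact Finset.prod_ne_zero_iff.2 (fun i _ => ha i) (congrFun (congrFun h a) a')

theorem tensor_eq_zero {A : ∀ i, Matrix (k i) (k i) ℂ} {i : σ} (h : A i = 0) : tensor A = 0 := by
  ext a a'
  exact Finset.prod_eq_zero (Finset.mem_univ i) (by rw [h]; rfl)

variable [DecidableEq σ]

/-- The tensor product as a multilinear map. -/
def tensorMultilinear (k : σ → Type*) :
    MultilinearMap ℂ (fun i => Matrix (k i) (k i) ℂ) (Matrix (∀ i, k i) (∀ i, k i) ℂ) where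
  toFun := tensor
  map_update_add' {inst} A i X Y := by
    ext a a'
    exact ((MultilinearMap.mkPiAlgebra ℂ σ ℂ).compLinearMap
      fun i => Matrix.entryLinearMap ℂ ℂ (a i) (a' i)).map_update_add A i X Y
  map_update_smul' {inst} A i c X := by
    ext a a'
    exact ((MultilinearMap.mkPiAlgebra ℂ σ ℂ).compLinearMap
      fun i => Matrix.entryLinearMap ℂ ℂ (a i) (a' i)).map_update_smul A i c X

omit [DecidableEq σ] in
theorem tensor_smul (c : σ → ℂ) (A : ∀ i, Matrix (k i) (k i) ℂ) :
    tensor (fun i => c i • A i) = (∏ i, c i) • tensor A :=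
  (tensorMultilinear k).map_smul_univ c A

theorem tensor_sum {ι : σ → Type*} [∀ i, Fintype (ι i)] (A : ∀ i, ι i → Matrix (k i) (k i) ℂ) :
    tensor (fun i => ∑ j, A i j) = ∑ J : ∀ i, ι i, tensor fun i => A i (J i) :=
  (tensorMultilinear k).map_sum A

variable [∀ i, Fintype (k i)]

theorem tensor_mul (A B : ∀ i, Matrix (k i) (k i) ℂ) :
    tensor A * tensor B = tensor fun i => A i * B i := by
  ext a a'
  simp only [tensor, mul_apply, of_apply, ← Finset.prod_mul_distrib]
  exact (Fintype.prod_sum fun i j => A i (a i) j * B i j (a' i)).symm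

variable [∀ i, DecidableEq (k i)]

/-- Linear maps agreeing on product matrices are equal. -/
theorem ext_tensor {E : Type*} [AddCommGroup E] [Module ℂ E]
    {L L' : Matrix (∀ i, k i) (∀ i, k i) ℂ →ₗ[ℂ] E} (h : ∀ A, L (tensor A) = L' (tensor A)) :
    L = L' := by
  refine (Matrix.stdBasis ℂ (∀ i, k i) (∀ i, k i)).ext fun p => ?_
  have : Matrix.stdBasis ℂ (∀ i, k i) (∀ i, k i) p =
      tensor fun i => single (p.1 i) (p.2 i) 1 := by
    rw [Matrix.stdBasis_eq_single]
    ext a a'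
    simp only [tensor, of_apply, single_apply]
    rw [Fintype.prod_boole]
    simp only [funext_iff, forall_and]
  rw [this, h]

theorem tensor_posSemidef {A : ∀ i, Matrix (k i) (k i) ℂ} (h : ∀ i, (A i).PosSemidef) :
    (tensor A).PosSemidef := by
  choose C hC using fun i => exists_eq_conjTranspose_mul_self (h i)
  have : tensor A = (tensor C)ᴴ * tensor C := by
    rw [tensor_conjTranspose, tensor_mul]
    exact congrArg tensor (funext hC)
  rw [this]
  exact posSemidef_conjTranspose_mul_self _

omit [∀ i, DecidableEq (k i)] in
theorem tensor_isStarProjection {V : ∀ i, Matrix (k i) (k i) ℂ}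
    (h : ∀ i, IsStarProjection (V i)) : IsStarProjection (tensor V) := by
  refine ⟨?_, ?_⟩
  · change tensor V * tensor V = tensor V
    rw [tensor_mul]
    exact congrArg tensor (funext fun i => (h i).isIdempotentElem.eq)
  · change (tensor V)ᴴ = tensor V
    rw [tensor_conjTranspose]
    exact congrArg tensor (funext fun i => (h i).isSelfAdjoint)

omit [∀ i, DecidableEq (k i)] in
theorem IsSupport.tensor {V X D : ∀ i, Matrix (k i) (k i) ℂ}
    (h : ∀ i, IsSupport (V i) (X i) (D i)) :
    IsSupport (tensor V) (tensor X) (tensor D) where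
  isStarProjection := tensor_isStarProjection fun i => (h i).isStarProjection
  mul_left := by rw [tensor_mul]; exact congrArg _ (funext fun i => (h i).mul_left)
  mul_right := by rw [tensor_mul]; exact congrArg _ (funext fun i => (h i).mul_right)
  eq_mul := by rw [tensor_mul]; exact congrArg _ (funext fun i => (h i).eq_mul)
  eq_mul' := by rw [tensor_mul]; exact congrArg _ (funext fun i => (h i).eq_mul')

end Tensor

/-! ### The shuffle acts factorwise on product matrices. -/

section ShuffleMaps

variable {σ : Type*} [Fintype σ] [DecidableEq σ] {k m : σ → Type*}
  [∀ i, Fintype (k i)] [∀ i, Fintype (m i)]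

omit [∀ i, Fintype (m i)] in
theorem mapG_shuffle_tensor (γ : ∀ i, Matrix (k i × m i) (k i × m i) ℂ)
    (X : ∀ i, Matrix (k i) (k i) ℂ) :
    mapG (shuffle γ) (tensor X) = tensor fun i => mapG (γ i) (X i) := by
  ext b b'
  simp only [mapG, LinearMap.coe_mk, AddHom.coe_mk, of_apply, shuffle, tensor,
    ← Finset.prod_mul_distrib, Fintype.prod_sum]

omit [∀ i, Fintype (k i)] in
theorem mapF_shuffle_tensor (γ : ∀ i, Matrix (k i × m i) (k i × m i) ℂ)
    (Y : ∀ i, Matrix (m i) (m i) ℂ) :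
    mapF (shuffle γ) (tensor Y) = tensor fun i => mapF (γ i) (Y i) := by
  simp only [mapF_eq_mapG_submatrix]
  exact mapG_shuffle_tensor (fun i => (γ i).submatrix Prod.swap Prod.swap) Y

/-- The shuffle is the tensor product of the states with its indices regrouped. -/
theorem shuffle_posSemidef [∀ i, DecidableEq (k i)] [∀ i, DecidableEq (m i)]
    {γ : ∀ i, Matrix (k i × m i) (k i × m i) ℂ}
    (h : ∀ i, (γ i).PosSemidef) : (shuffle γ).PosSemidef :=
  (tensor_posSemidef h).submatrix fun (p : (∀ i, k i) × (∀ i, m i)) i => (p.1 i, p.2 i)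

end ShuffleMaps

/-! ### Tensor products of self-adjoint positive maps. -/

section TensorMaps

variable {σ : Type*} [Fintype σ] [DecidableEq σ] {k : σ → Type*} [∀ i, Fintype (k i)]
  [∀ i, DecidableEq (k i)]

/-- A product of bounded nonnegative factors attains the product of the positive bounds only if
every factor attains its bound. -/
theorem eq_of_prod_eq_prod {σ : Type*} [Fintype σ] {μ r : σ → ℝ} (h0 : ∀ i, 0 ≤ μ i)
    (hle : ∀ i, μ i ≤ r i) (hr : ∀ i, 0 < r i) (h : ∏ i, μ i = ∏ i, r i) (i : σ) :
    μ i = r i := by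
  by_contra hne
  have hpos : ∀ j ∈ Finset.univ, 0 < μ j := by
    intro j hj
    refine lt_of_le_of_ne (h0 j) fun hj0 => ?_
    rw [Finset.prod_eq_zero hj hj0.symm] at h
    exact (Finset.prod_pos fun i _ => hr i).ne h
  exact (Finset.prod_lt_prod hpos (fun j _ => hle j)
    ⟨i, Finset.mem_univ i, lt_of_le_of_ne (hle i) hne⟩).ne h

/-- If the largest eigenvalues of the compressed factors are simple, then so is that of the
compressed tensor product. -/
theorem exists_eq_smul_tensor {T : Matrix (∀ i, k i) (∀ i, k i) ℂ →ₗ[ℂ] _}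
    (hT : IsSelfAdjointPositive T) {t : ∀ i, Matrix (k i) (k i) ℂ →ₗ[ℂ] Matrix (k i) (k i) ℂ}
    (ht : ∀ i, IsSelfAdjointPositive (t i))
    (hTt : ∀ A, T (tensor A) = tensor fun i => t i (A i))
    {V X D : ∀ i, Matrix (k i) (k i) ℂ} {r : σ → ℝ} (hr : ∀ i, 0 < r i)
    (hX : ∀ i, (X i).PosSemidef) (hV : ∀ i, IsSupport (V i) (X i) (D i))
    (htX : ∀ i, t i (X i) = (r i : ℂ) • X i)
    (htop : ∀ i, IsTopValue (compression (V i) ∘ₗ t i ∘ₗ compression (V i)) (r i))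
    (hsimple : ∀ i, ∀ Y, (compression (V i) ∘ₗ t i ∘ₗ compression (V i)) Y = (r i : ℂ) • Y →
      ∃ c : ℂ, Y = c • X i)
    {Y : Matrix (∀ i, k i) (∀ i, k i) ℂ} (hY : Y ∈ corner (tensor V))
    (hTY : T Y = (∏ i, (r i : ℂ)) • Y) : ∃ c : ℂ, Y = c • tensor X := by
  have hVt := IsSupport.tensor hV
  have hXt := tensor_posSemidef hX
  have hTX : T (tensor X) = (∏ i, (r i : ℂ)) • tensor X := by
    rw [hTt, ← tensor_smul]
    exact congrArg tensor (funext htX)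
  -- It suffices that an eigenvector orthogonal to the product of Perron vectors vanishes. This is
  -- tested against products of eigenvectors of the compressed factors, which determine a functional
  -- on product matrices by multilinearity.
  have key : ∀ Z ∈ corner (tensor V), T Z = (∏ i, (r i : ℂ)) • Z → (Z * tensor X).trace = 0 →
      Z = 0 := by
    intro Z hZ hTZ hZX
    obtain ⟨hZ1, hZ2⟩ := (mem_corner hVt.isStarProjection).1 hZ
    have htr : ∀ A : Matrix (∀ i, k i) (∀ i, k i) ℂ,
        (Z * (tensor V * A * tensor V)).trace = (Z * A).trace := by
      intro A
      rw [← mul_assoc, ← mul_assoc, hZ2, trace_mul_comm, ← mul_assoc, hZ1]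
    choose N b μ hb using fun i => ((ht i).compress (V := V i)
      (hV i).isStarProjection.isSelfAdjoint).exists_eigenbasis
    have hprod : ∀ A : ∀ i, Matrix (k i) (k i) ℂ, tensor V * tensor A * tensor V =
        tensor fun i => V i * A i * V i := fun A => by rw [tensor_mul, tensor_mul]
    have hstep : ∀ A : ∀ i, Matrix (k i) (k i) ℂ, (∏ i, (r i : ℂ)) * (Z * tensor A).trace =
        (Z * tensor fun i => (compression (V i) ∘ₗ t i ∘ₗ compression (V i)) (A i)).trace := by
      intro A
      have h1 : (fun i => (compression (V i) ∘ₗ t i ∘ₗ compression (V i)) (A i)) =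
        fun i => V i * t i (V i * A i * V i) * V i := rfl
      rw [h1, ← hprod, htr, ← hTt, ← hT.trace_mul, hTZ, smul_mul, trace_smul, ← hprod, htr,
        smul_eq_mul]
    have hzero : (((traceLinearMap (∀ i, k i) ℂ ℂ) ∘ₗ
        LinearMap.mulLeft ℂ Z).compMultilinearMap (tensorMultilinear k)) = 0 := by
      refine Module.Basis.ext_multilinear b fun J => ?_
      change (Z * tensor fun i => b i (J i)).trace = 0
      have h1 := hstep fun i => b i (J i)
      simp only [hb] at h1
      rw [tensor_smul, Matrix.mul_smul, trace_smul, smul_eq_mul] at h1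
      -- If the products agree, then, as `0 ≤ μ i ≤ r i`, every factor is top, so the test matrix is
      -- a multiple of `tensor X`, to which `Z` is orthogonal. If they differ, eigenvectors for
      -- different eigenvalues are orthogonal.
      by_cases hμ : ∏ i, μ i (J i) = ∏ i, r i
      · have hb0 : ∀ i, b i (J i) ≠ 0 := fun i => (b i).ne_zero (J i)
        have hT' : ∀ i, ((compression (V i) ∘ₗ t i ∘ₗ compression (V i)) (b i (J i)) *
            (b i (J i))ᴴ).trace.re = μ i (J i) * (b i (J i) * (b i (J i))ᴴ).trace.re := by
          intro i
          rw [hb, smul_mul, trace_smul]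
          simp
        have hn : ∀ i, 0 < (b i (J i) * (b i (J i))ᴴ).trace.re :=
          fun i => trace_mul_conjTranspose_re_pos (hb0 i)
        have hnonneg : ∀ i, 0 ≤ μ i (J i) := by
          intro i
          have h2 := (Complex.nonneg_iff.1 (((ht i).compress (V := V i)
            (hV i).isStarProjection.isSelfAdjoint).trace_nonneg (b i (J i)))).1
          rw [hT' i] at h2
          exact nonneg_of_mul_nonneg_left h2 (hn i)
        have hle : ∀ i, μ i (J i) ≤ r i := by
          intro i
          have h2 := (htop i).le (b i (J i))
          rw [hT' i] at h2
          exact le_of_mul_le_mul_right h2 (hn i)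
        have heq := eq_of_prod_eq_prod hnonneg hle hr hμ
        choose c hc using fun i => hsimple i (b i (J i)) (by rw [hb, heq])
        have h3 : (fun i => b i (J i)) = fun i => c i • X i := funext hc
        rw [h3, tensor_smul, Matrix.mul_smul, trace_smul, hZX, smul_zero]
      · have h2 : (∏ i, (μ i (J i) : ℂ)) ≠ ∏ i, (r i : ℂ) := by exact_mod_cast hμ
        by_contra h3
        exact h2 (mul_right_cancel₀ h3 h1).symm
    have hlin : (traceLinearMap (∀ i, k i) ℂ ℂ) ∘ₗ LinearMap.mulLeft ℂ Z = 0 :=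
      ext_tensor fun A => congrFun (congrArg DFunLike.coe hzero) A
    rw [Matrix.ext_iff_trace_mul_right]
    intro B
    rw [zero_mul, trace_zero]
    exact LinearMap.congr_fun hlin B
  have hXX : (tensor X * tensor X).trace = 0 → tensor X = 0 := fun h =>
    trace_mul_conjTranspose_self_eq_zero_iff.1 (by rw [hXt.isHermitian.eq, h])
  refine ⟨(Y * tensor X).trace / (tensor X * tensor X).trace, sub_eq_zero.1 (key _ ?_ ?_ ?_)⟩
  · exact Submodule.sub_mem _ hY (Submodule.smul_mem _ _
      ((mem_corner hVt.isStarProjection).2 ⟨hVt.mul_left, hVt.mul_right⟩))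
  · rw [map_sub, map_smul, hTY, hTX, smul_sub, smul_comm]
  · rw [sub_mul, trace_sub, smul_mul, trace_smul, smul_eq_mul]
    -- The hypotheses allow `tensor X = 0`; the quotient is then `0` by convention and the claim
    -- still holds.
    by_cases h : (tensor X * tensor X).trace = 0
    · rw [hXX h]; simp
    · rw [div_mul_cancel₀ _ h, sub_self]

/-- The tensor product of block systems is a block system. -/
theorem IsBlockSystem.tensor {T : Matrix (∀ i, k i) (∀ i, k i) ℂ →ₗ[ℂ] _}
    (hT : IsSelfAdjointPositive T) {t : ∀ i, Matrix (k i) (k i) ℂ →ₗ[ℂ] Matrix (k i) (k i) ℂ}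
    (ht : ∀ i, IsSelfAdjointPositive (t i))
    (hTt : ∀ A, T (tensor A) = tensor fun i => t i (A i)) {ι : σ → Type*} [∀ i, Fintype (ι i)]
    {W : ∀ i, ι i → Matrix (k i) (k i) ℂ} (hW : ∀ i, IsBlockSystem (t i) (W i)) :
    IsBlockSystem T fun J : ∀ i, ι i => tensor fun i => W i (J i) := by
  have hp : ∀ J : ∀ i, ι i, IsStarProjection (ShuffleStates.tensor fun i => W i (J i)) :=
    fun J => tensor_isStarProjection fun i => (hW i).isStarProjection (J i)
  have hcomp : ∀ (J : ∀ i, ι i) (A : ∀ i, Matrix (k i) (k i) ℂ),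
      (ShuffleStates.tensor fun i => W i (J i)) * ShuffleStates.tensor A *
        (ShuffleStates.tensor fun i => W i (J i)) =
      ShuffleStates.tensor fun i => W i (J i) * A i * W i (J i) :=
    fun J A => by rw [tensor_mul, tensor_mul]
  refine ⟨hp, ?_, ?_, ?_, ?_, ?_⟩
  · intro J K hJK
    obtain ⟨i, hi⟩ := Function.ne_iff.1 hJK
    rw [tensor_mul]
    exact tensor_eq_zero ((hW i).mul_eq_zero _ _ hi)
  · intro J
    set V := ShuffleStates.tensor fun i => W i (J i) with hV
    have h : T ∘ₗ compression V = compression V ∘ₗ T ∘ₗ compression V := by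
      refine ext_tensor fun A => ?_
      change T (V * ShuffleStates.tensor A * V) = V * T (V * ShuffleStates.tensor A * V) * V
      rw [hV, hcomp, hTt, hcomp]
      congr 1
      funext i
      obtain ⟨h1, h2⟩ := (mem_corner ((hW i).isStarProjection (J i))).1
        ((hW i).leavesInvariant (J i) _ ⟨A i, rfl⟩)
      rw [h1, h2]
    rintro _ ⟨A, rfl⟩
    exact ⟨_, LinearMap.congr_fun h A⟩
  · intro J
    choose r X D hr hX hV htX htop hsimple using fun i => (ht i).exists_perron
      ((hW i).isStarProjection (J i)) ((hW i).leavesInvariant (J i))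
      ((hW i).isIrreducibleOn (J i)) ((hW i).exists_ne_zero (J i))
    refine hT.isIrreducibleOn_of_simple (c := ∏ i, (r i : ℂ)) (tensor_posSemidef hX)
      (IsSupport.tensor hV) ?_ ?_
    · rw [hTt, ← tensor_smul]
      exact congrArg _ (funext htX)
    · exact fun Y hY hTY => exists_eq_smul_tensor hT ht hTt hr hX hV htX htop hsimple hY hTY
  · intro J
    choose Y hY hne using fun i => (hW i).exists_ne_zero (J i)
    refine ⟨ShuffleStates.tensor Y, ⟨ShuffleStates.tensor Y, ?_⟩, ?_⟩
    · rw [hcomp]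
      congr 1
      funext i
      obtain ⟨h1, h2⟩ := (mem_corner ((hW i).isStarProjection (J i))).1 (hY i)
      rw [h1, h2]
    · rw [hTt]
      intro h
      obtain ⟨i, hi⟩ := exists_eq_zero_of_tensor_eq_zero h
      exact hne i hi
  · intro Y
    have h : T = ∑ J : ∀ i, ι i, T ∘ₗ compression (ShuffleStates.tensor fun i => W i (J i)) := by
      refine ext_tensor fun A => ?_
      rw [LinearMap.sum_apply, hTt]
      have h1 : (fun i => t i (A i)) = fun i => ∑ j, t i (W i j * A i * W i j) :=
        funext fun i => (hW i).apply_eq_sum (A i)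
      rw [h1, tensor_sum]
      refine Finset.sum_congr rfl fun J _ => ?_
      change _ = T (_ * _ * _)
      rw [hcomp, hTt]
    conv_lhs => rw [h]
    rw [LinearMap.sum_apply]
    rfl

/-- The decomposition property passes from a tensor product to its factors. -/
theorem HasDecompositionProperty.of_tensor {T : Matrix (∀ i, k i) (∀ i, k i) ℂ →ₗ[ℂ] _}
    {t : ∀ i, Matrix (k i) (k i) ℂ →ₗ[ℂ] Matrix (k i) (k i) ℂ}
    (ht : ∀ i, IsSelfAdjointPositive (t i)) (ht0 : ∀ i, t i ≠ 0)
    (hTt : ∀ A, T (tensor A) = tensor fun i => t i (A i)) (hdec : HasDecompositionProperty T)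
    (i : σ) : HasDecompositionProperty (t i) := by
  intro X₀ V₀ D₀ r₀ hX₀ hr₀ htX₀ hV₀ A
  by_cases hX0 : X₀ = 0
  · rw [hV₀.eq_mul, hX0]
    simp
  let P : ∀ j, Matrix (k j) (k j) ℂ × Matrix (k j) (k j) ℂ × Matrix (k j) (k j) ℂ × ℝ → Prop :=
    fun j q => q.1.PosSemidef ∧ q.1 ≠ 0 ∧ 0 < q.2.2.2 ∧ t j q.1 = (q.2.2.2 : ℂ) • q.1 ∧
      IsSupport q.2.1 q.1 q.2.2.1
  have hex : ∀ j, ∃ q, P j q := by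
    intro j
    obtain ⟨r, hr, -, X, hX, hX0, htX⟩ := (ht j).exists_posSemidef_eigenvector (ht0 j)
    obtain ⟨V, D, hV⟩ := exists_isSupport hX.isHermitian
    exact ⟨(X, V, D, r), hX, hX0, hr, htX, hV⟩
  let q₀ : {q // P i q} := ⟨(X₀, V₀, D₀, r₀), hX₀, hX0, hr₀, htX₀, hV₀⟩
  -- The given eigenvector sits in slot `i`; the other slots hold nonzero positive semidefinite
  -- eigenvectors with positive eigenvalue, which exist because every `t j` is nonzero.
  obtain ⟨f, hf⟩ : ∃ f : ∀ j, {q // P j q}, f i = q₀ :=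
    ⟨Function.update (fun j => ⟨_, (hex j).choose_spec⟩) i q₀, Function.update_self ..⟩
  let X : ∀ j, Matrix (k j) (k j) ℂ := fun j => (f j).1.1
  let V : ∀ j, Matrix (k j) (k j) ℂ := fun j => (f j).1.2.1
  let D : ∀ j, Matrix (k j) (k j) ℂ := fun j => (f j).1.2.2.1
  let r : σ → ℝ := fun j => (f j).1.2.2.2
  have hX : ∀ j, (X j).PosSemidef := fun j => (f j).2.1
  have hXne : ∀ j, X j ≠ 0 := fun j => (f j).2.2.1
  have hr : ∀ j, 0 < r j := fun j => (f j).2.2.2.1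
  have htX : ∀ j, t j (X j) = (r j : ℂ) • X j := fun j => (f j).2.2.2.2.1
  have hV : ∀ j, IsSupport (V j) (X j) (D j) := fun j => (f j).2.2.2.2.2
  have hVi : V i = V₀ := by change (f i).1.2.1 = V₀; rw [hf]
  let Z : ∀ j, Matrix (k j) (k j) ℂ := Function.update X i (V₀ * A * (1 - V₀))
  have hZi : Z i = V₀ * A * (1 - V₀) := Function.update_self ..
  have hZj : ∀ j, j ≠ i → Z j = X j := fun j hj => Function.update_of_ne hj ..
  have hV₀V₀ : V₀ * V₀ = V₀ := hV₀.isStarProjection.isIdempotentElem.eq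
  have hVZ : tensor V * tensor Z = tensor Z := by
    rw [tensor_mul]
    congr 1
    funext j
    by_cases hj : j = i
    · subst hj
      rw [hZi, hVi, ← mul_assoc, ← mul_assoc, hV₀V₀]
    · rw [hZj j hj, (hV j).mul_left]
  have hZV : tensor Z * tensor V = 0 := by
    rw [tensor_mul]
    refine tensor_eq_zero (i := i) ?_
    rw [hZi, hVi, mul_assoc, sub_mul, one_mul, hV₀V₀, sub_self, mul_zero]
  have htZ := hdec (tensor X) (tensor V) (tensor D) (∏ j, r j) (tensor_posSemidef hX)
    (Finset.prod_pos fun j _ => hr j) (by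
      rw [hTt, Complex.ofReal_prod, ← tensor_smul]
      exact congrArg _ (funext htX)) (IsSupport.tensor hV) (tensor Z)
  rw [hVZ, mul_sub, mul_one, hZV, sub_zero, hTt] at htZ
  -- The vanishing product has a zero factor. It can only be the one in slot `i`, since the others
  -- are `r j` times `X j`, which is nonzero.
  obtain ⟨j, hj⟩ := exists_eq_zero_of_tensor_eq_zero htZ
  by_cases hji : j = i
  · subst hji
    rwa [hZi] at hj
  · rw [hZj j hji, htX] at hj
    exact absurd hj (smul_ne_zero (by exact_mod_cast (hr j).ne') (hXne j))

end TensorMaps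

/-! ### The two implications for shuffles. -/

section Main

variable {σ : Type*} [Fintype σ] [DecidableEq σ] {k m : σ → Type*} [∀ i, Fintype (k i)]
  [∀ i, DecidableEq (k i)] [∀ i, Fintype (m i)] [∀ i, DecidableEq (m i)]

omit [∀ i, DecidableEq (k i)] [∀ i, DecidableEq (m i)] in
theorem comp_shuffle_tensor (γ : ∀ i, Matrix (k i × m i) (k i × m i) ℂ)
    (A : ∀ i, Matrix (k i) (k i) ℂ) :
    (mapF (shuffle γ) ∘ₗ mapG (shuffle γ)) (tensor A) =
      tensor fun i => (mapF (γ i) ∘ₗ mapG (γ i)) (A i) := by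
  rw [LinearMap.comp_apply, mapG_shuffle_tensor, mapF_shuffle_tensor]
  rfl

theorem isCompletelyReducibleState_shuffle {γ : ∀ i, Matrix (k i × m i) (k i × m i) ℂ}
    (h : ∀ i, IsCompletelyReducibleState (γ i)) : IsCompletelyReducibleState (shuffle γ) := by
  have hS := shuffle_posSemidef fun i => (h i).1
  choose ι hι W hW using fun i => (h i).2.exists_isBlockSystem
  exact ⟨hS, (IsBlockSystem.tensor (isSelfAdjointPositive_comp hS)
    (fun i => isSelfAdjointPositive_comp (h i).1) (comp_shuffle_tensor γ)
    hW).isCompletelyReducibleMap⟩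

omit [∀ i, DecidableEq (m i)] in
theorem IsCompletelyReducibleState.of_shuffle {γ : ∀ i, Matrix (k i × m i) (k i × m i) ℂ}
    (hγ : ∀ i, (γ i).PosSemidef) (h0 : ∀ i, γ i ≠ 0)
    (h : IsCompletelyReducibleState (shuffle γ)) (i : σ) : IsCompletelyReducibleState (γ i) := by
  obtain ⟨ι, hι, W, hW⟩ := h.2.exists_isBlockSystem
  have hdec := (isSelfAdjointPositive_comp h.1).hasDecompositionProperty hW
  obtain ⟨κ, hκ, U, hU⟩ := (isSelfAdjointPositive_comp (hγ i)).exists_isBlockSystem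
    (HasDecompositionProperty.of_tensor (fun i => isSelfAdjointPositive_comp (hγ i))
      (fun i => comp_ne_zero (hγ i).isHermitian (h0 i)) (comp_shuffle_tensor γ) hdec i)
  exact ⟨hγ i, hU.isCompletelyReducibleMap⟩

end Main

end ShuffleStates

theorem mainTheorem4 (s : ℕ) (k m : Fin s → ℕ)
    (γ : ∀ i : Fin s, Matrix (Fin (k i) × Fin (m i)) (Fin (k i) × Fin (m i)) ℂ)
    (hγ : ∀ i, (γ i).PosSemidef) :
    ((∀ i, ShuffleStates.IsCompletelyReducibleState (γ i)) →
      ShuffleStates.IsCompletelyReducibleState (ShuffleStates.shuffle γ)) ∧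
    ((∀ i, γ i ≠ 0) →
      (ShuffleStates.IsCompletelyReducibleState (ShuffleStates.shuffle γ) ↔
        ∀ i, ShuffleStates.IsCompletelyReducibleState (γ i))) := by
  refine ⟨ShuffleStates.isCompletelyReducibleState_shuffle, fun h0 => ⟨fun h i => ?_,
    ShuffleStates.isCompletelyReducibleState_shuffle⟩⟩
  exact ShuffleStates.IsCompletelyReducibleState.of_shuffle hγ h0 h i
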